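/- Let $\mathcal{O}:\{0,1\}^*\to\{0,1\}$ be a uniformly random oracle (the bits $\mathcal{O}(x)$, $x\in\{0,1\}^*$, are independent fair coins). Then, with probability $1$ over $\mathcal{O}$, $$\mathsf{PP}^{\mathcal{O}}\not\subseteq\mathsf{QMAH}^{\mathcal{O}}.$$ Here $\mathsf{QMAH}$ is the $\mathsf{QMA}$ hierarchy, defined relative to $\mathcal{O}$ as follows. A promise problem is a function $\Pi:\{0,1\}^*\to\{0,1,\bot\}$, and a language $A:\{0,1\}^*\to\{0,1\}$ extends $\Pi$ if $A(x)=\Pi(x)$ whenever $\Pi(x)\neq\bot$. A $\mathsf{QMA}$ verifier $V$ is a polynomial-time uniform family of quantum circuits with oracle gates which act on a polynomial-size quantum witness; with a given oracle, $V$ decides a promise problem $P$ if for every $x$ with $P(x)=1$ some witness state is accepted with probability at least $2/3$, and for every $x$ with $P(x)=0$ every witness state is accepted with probability at most $1/3$. A promise problem $P$ is in $\mathsf{PromiseQMA}^{\Pi}$ (relative to $\mathcal{O}$) if there is a single verifier $V$, with query access to $\mathcal{O}$ and to a language $A$, that decides $P$ for every language $A$ extending $\Pi$. For a class $\mathcal{C}$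 of promise problems, $\mathsf{PromiseQMA}^{\mathcal{C}}=\bigcup_{\Pi\in\mathcal{C}}\mathsf{PromiseQMA}^{\Pi}$. Put $\mathsf{PromiseQMAH}_0=\mathsf{PromiseP}$ (relative to $\mathcal{O}$) and $\mathsf{PromiseQMAH}_k=\mathsf{PromiseQMA}^{\mathsf{PromiseQMAH}_{k-1}}$ for $k\ge 1$. Finally, $\mathsf{QMAH}^{\mathcal{O}}$ is the set of languages (total promise problems) in $\bigcup_{k\ge1}\mathsf{PromiseQMAH}_k$. -/

import Mathlib

namespace QMAHierarchy

/-! ## Languages, promise problems, random oracles -/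

/-- A language `{0,1}* → {0,1}`. Oracles are languages. -/
abbrev BitLanguage : Type := List Bool → Bool

/-- A promise problem `{0,1}* → {0,1,⊥}`; `none` is the value `⊥`. -/
abbrev PromiseProblem : Type := List Bool → Option Bool

/-- `A` extends the promise problem `Q`: they agree wherever `Q` is defined. -/
def Extends (A : BitLanguage) (Q : PromiseProblem) : Prop :=
  ∀ x b, Q x = some b → A x = b

/-- A total promise problem, that is, a language regarded as a promise problem. -/
def BitLanguage.toPromise (L : BitLanguage) : PromiseProblem := fun x => some (L x)

/-- Access to two oracles: a query `0x` is answered by `O x`, a query `1x` by `A x`. -/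
def join (O A : BitLanguage) : BitLanguage
  | [] => false
  | false :: x => O x
  | true :: x => A x

/-- The law of a uniformly random language: the bits `O x`, for `x ∈ {0,1}*`, are independent and
each is a fair coin. -/
noncomputable def randomOracle : MeasureTheory.Measure BitLanguage :=
  MeasureTheory.Measure.infinitePi fun _ : List Bool => (PMF.uniformOfFintype Bool).toMeasure

/-! ## Deterministic oracle machines with a step count

The machines have a finite program and finitely many pushdown stacks over `{0,1}` (a pair of stacks
is a Turing tape, the top of one of them being the scanned cell), so that, up to a polynomial
overhead, they are the multitape oracle Turing machines.
Stack `0` is the input, stack `1` is the auxiliary input (the random string of a probabilistic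
machine), stack `2` is the query tape, stack `3` is the output tape, and the others are work tapes.
The string on a stack is read from the top. -/

/-- The instructions; every instruction names its successors. -/
inductive Instr : Type
  /-- push the bit `b` on stack `s`, then go to `next` -/
  | push (s : ℕ) (b : Bool) (next : ℕ)
  /-- pop stack `s` and branch on the bit removed, or on the stack being empty -/
  | pop (s : ℕ) (ifEmpty ifFalse ifTrue : ℕ)
  /-- ask the oracle about the string on stack `2` and branch on its answer -/
  | query (ifFalse ifTrue : ℕ)

/-- A program is a list of instructions. It starts at instruction `0`, and it halts when it is sent
to a position where there is no instruction. -/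
abbrev Machine : Type := List Instr

/-- A configuration: the position in the program and the contents of the stacks. -/
structure Config : Type where
  pos : ℕ
  stack : ℕ → List Bool

/-- One step with oracle `O`; `none` if the machine has halted. -/
def Machine.step (M : Machine) (O : BitLanguage) (c : Config) : Option Config :=
  match M[c.pos]? with
  | none => none
  | some (.push s b next) => some ⟨next, Function.update c.stack s (b :: c.stack s)⟩
  | some (.pop s ifEmpty ifFalse ifTrue) =>
    match c.stack s with
    | [] => some ⟨ifEmpty, c.stack⟩
    | false :: w => some ⟨ifFalse, Function.update c.stack s w⟩
    | true :: w => some ⟨ifTrue, Function.update c.stack s w⟩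
  | some (.query ifFalse ifTrue) => some ⟨if O (c.stack 2) then ifTrue else ifFalse, c.stack⟩

/-- The configuration after `t` steps (the last one reached, if the machine halts earlier). -/
def Machine.run (M : Machine) (O : BitLanguage) : ℕ → Config → Config
  | 0, c => c
  | t + 1, c =>
    match M.step O c with
    | none => c
    | some c' => M.run O t c'

/-- The initial configuration on input `x` and auxiliary input `r`. -/
def initConfig (x r : List Bool) : Config where
  pos := 0
  stack := fun s => if s = 0 then x else if s = 1 then r else []

/-- With oracle `O`, on input `x` and auxiliary input `r`, the machine `M` halts after at most `t`
steps and its output is `y`. -/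
def Machine.OutputsWithin (M : Machine) (O : BitLanguage) (x r : List Bool) (t : ℕ)
    (y : List Bool) : Prop :=
  M.step O (M.run O t (initConfig x r)) = none ∧ (M.run O t (initConfig x r)).stack 3 = y

/-! ## The classes `PromiseP` and `PP` relative to an oracle -/

/-- `PromiseP` relative to `O`. -/
def PromiseP (O : BitLanguage) : Set PromiseProblem :=
  {Q | ∃ (M : Machine) (p : Polynomial ℕ), ∀ x b, Q x = some b →
    M.OutputsWithin O x [] (p.eval x.length) [b]}

/-- `PP` relative to `O`: there are a polynomial-time machine `M` with oracle `O` and a polynomial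
`q` such that `M`, on input `x` and a random string of length `q(|x|)`, always outputs one bit, and
`x` is in the language if and only if more than half of the random strings lead to the output `1`.
-/
def PP (O : BitLanguage) : Set BitLanguage :=
  {L | ∃ (M : Machine) (p q : Polynomial ℕ), ∀ x,
    (∀ r : List Bool, r.length = q.eval x.length →
      ∃ b, M.OutputsWithin O x r (p.eval x.length) [b]) ∧
    (L x = true ↔
      2 ^ q.eval x.length < 2 * Set.ncard {r : List Bool |
        r.length = q.eval x.length ∧ M.OutputsWithin O x r (p.eval x.length) [true]})}

/-! ## Quantum circuits with oracle gates -/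

/-- The pure states of `n` qubits are the unit vectors of this Hilbert space. -/
abbrev QState (n : ℕ) : Type := EuclideanSpace ℂ (Fin n → Bool)

/-- Gates on `n` qubits: Hadamard, `diag(1, i)`, Toffoli, and oracle gates of any arity. -/
inductive Gate (n : ℕ) : Type
  | hadamard (i : Fin n)
  | phase (i : Fin n)
  | toffoli (i j target : Fin n) (distinct : [i, j, target].Nodup)
  | oracle (wires : List (Fin n)) (target : Fin n) (distinct : (target :: wires).Nodup)

/-- The unitary transformation of a gate, where oracle gates query `A`. Toffoli maps
`|a⟩|b⟩|c⟩` to `|a⟩|b⟩|c ⊕ (a ∧ b)⟩`, and an oracle gate maps `|y⟩|c⟩` to `|y⟩|c ⊕ A(y)⟩`. -/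
noncomputable def Gate.apply {n : ℕ} (A : BitLanguage) (g : Gate n) (ψ : QState n) : QState n :=
  match g with
  | .hadamard i => WithLp.toLp 2 fun z =>
      ((Real.sqrt 2 : ℝ) : ℂ)⁻¹ * (ψ (Function.update z i false) +
        (if z i then -1 else 1) * ψ (Function.update z i true))
  | .phase i => WithLp.toLp 2 fun z => (if z i then Complex.I else 1) * ψ z
  | .toffoli i j target _ => WithLp.toLp 2 fun z =>
      ψ (Function.update z target (xor (z target) (z i && z j)))
  | .oracle wires target _ => WithLp.toLp 2 fun z =>
      ψ (Function.update z target (xor (z target) (A (wires.map z))))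

/-- A verification circuit acts on a witness register of `witness` qubits, followed by `ancilla`
qubits in the state `|0⟩`; after its gates have been applied in order, the qubit `out` is measured in
the standard basis. -/
structure Circuit : Type where
  witness : ℕ
  ancilla : ℕ
  out : Fin (witness + ancilla)
  gates : List (Gate (witness + ancilla))

/-- The state `|φ⟩|0…0⟩`. -/
noncomputable def Circuit.initState (C : Circuit) (φ : QState C.witness) :
    QState (C.witness + C.ancilla) :=
  WithLp.toLp 2 fun z =>
    if ∀ j : Fin C.ancilla, z (Fin.natAdd C.witness j) = false then
      φ fun i => z (Fin.castAdd C.ancilla i)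
    else 0

/-- The state before the measurement. -/
noncomputable def Circuit.finalState (C : Circuit) (A : BitLanguage) (φ : QState C.witness) :
    QState (C.witness + C.ancilla) :=
  C.gates.foldl (fun ψ g => g.apply A ψ) (C.initState φ)

/-- The probability that the measurement of the output qubit gives `1`. -/
noncomputable def Circuit.acceptProb (C : Circuit) (A : BitLanguage) (φ : QState C.witness) : ℝ :=
  ∑ z : Fin (C.witness + C.ancilla) → Bool, if z C.out then ‖C.finalState A φ z‖ ^ 2 else 0

/-! ### Circuits as bit strings -/

/-- A natural number in unary, with an end marker. -/
def encodeNat (n : ℕ) : List Bool := List.replicate n true ++ [false]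

/-- A list, with a bit before each entry and an end marker. -/
def encodeList {α : Type} (f : α → List Bool) : List α → List Bool
  | [] => [false]
  | a :: l => true :: (f a ++ encodeList f l)

def Gate.encode {n : ℕ} : Gate n → List Bool
  | .hadamard i => false :: false :: encodeNat i
  | .phase i => false :: true :: encodeNat i
  | .toffoli i j target _ =>
      true :: false :: (encodeNat i ++ (encodeNat j ++ encodeNat target))
  | .oracle wires target _ =>
      true :: true :: (encodeList (fun i : Fin n => encodeNat i) wires ++ encodeNat target)

/-- The description of a circuit as a bit string; its length is at least the number of qubits plus
the number of gates. -/
def Circuit.encode (C : Circuit) : List Bool :=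
  encodeNat C.witness ++ (encodeNat C.ancilla ++ (encodeNat C.out ++ encodeList Gate.encode C.gates))

/-! ## `QMA` verifiers and the `QMA` hierarchy -/

/-- A `QMA` verifier: a family of verification circuits with oracle gates, the circuit for the input
`x` being computed from `x` by a polynomial-time machine (without oracle). -/
structure QMAVerifier : Type where
  circuit : List Bool → Circuit
  generator : Machine
  time : Polynomial ℕ
  generates : ∀ x, generator.OutputsWithin (fun _ => false) x [] (time.eval x.length)
    (circuit x).encode

/-- The verifier, with oracle `A`, decides the promise problem `Q`. -/
def QMAVerifier.Decides (V : QMAVerifier) (A : BitLanguage) (Q : PromiseProblem) : Prop :=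
  ∀ x,
    (Q x = some true →
      ∃ φ : QState (V.circuit x).witness, ‖φ‖ = 1 ∧ 2 / 3 ≤ (V.circuit x).acceptProb A φ) ∧
    (Q x = some false →
      ∀ φ : QState (V.circuit x).witness, ‖φ‖ = 1 → (V.circuit x).acceptProb A φ ≤ 1 / 3)

/-- `PromiseQMA` with queries to the promise problem `R`, relative to the oracle `O`: a single
verifier has to decide `Q` whichever language `A` extending `R` answers its queries. -/
def PromiseQMA (O : BitLanguage) (R : PromiseProblem) : Set PromiseProblem :=
  {Q | ∃ V : QMAVerifier, ∀ A : BitLanguage, Extends A R → V.Decides (join O A) Q}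

/-- The levels of the `QMA` hierarchy of promise problems, relative to `O`. -/
def PromiseQMAHLevel (O : BitLanguage) : ℕ → Set PromiseProblem
  | 0 => PromiseP O
  | k + 1 => ⋃ R ∈ PromiseQMAHLevel O k, PromiseQMA O R

/-- The `QMA` hierarchy of promise problems, relative to `O`. -/
def PromiseQMAH (O : BitLanguage) : Set PromiseProblem :=
  ⋃ k : ℕ, ⋃ _ : 1 ≤ k, PromiseQMAHLevel O k

/-- The `QMA` hierarchy relative to `O`: the languages in `PromiseQMAH`. -/
def QMAH (O : BitLanguage) : Set BitLanguage :=
  {L | L.toPromise ∈ PromiseQMAH O}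

end QMAHierarchy

namespace QMAHierarchy

/-! ## Gates are isometries -/

/-! The separating language asks whether the number of ones of the oracle among the strings of
length `n` reaches a threshold encoded in the input. It lies in `PP` for every oracle
(`thresholdLanguage_mem_PP`). Fix a machine at the bottom and a finite chain of verifiers above it,
fix the oracle away from length `n`, and view all answers as functions of a uniform point `x` of the
cube `{0,1}^N`, where `N = 2 ^ n`.

Each level of the chain collapses under a random restriction, as in the switching lemma for
constant-depth circuits. The invariant (`exists_certified`) is that on a set `R` of at least `N /
poly(n)` free coordinates, and for all but a fraction `O(2 ^ (-n))` of the points, every relevant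
answer inside the promise is the value of a function having at `x` a certificate of polynomial size
in `R`. For the machine, the certificate is the set of its queries. For a verifier, the hybrid
argument (`Circuit.exists_queryWeight`) says that an accepting witness survives every change of the
oracle on strings of small total query weight; spreading the weights over the certificates of the
level below gives weights on coordinates (`Circuit.exists_coordinateWeight`). A random colour class
catches little of the weight of light coordinates, and few coordinates are heavy. Hence "agree with
an accepting point off the class and at its heavy coordinates" is a term of small width in the
class, and the disjunction of these terms separates acceptance from rejection
(`exists_restriction_dnf`). A second colouring and the switching lemma (`card_switching`) turn it
into a function with small certificates (`exists_restriction_hasCert`). Outside the promise this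
function answers arbitrarily, which is allowed because the next verifier has to work with every
extension of the promise problem.

Small certificates cannot compute all thresholds (`mul_card_threshold_le`). Cut `R` into many blocks
of size `2 * k`. The certificates at `x` of the thresholds near its weight miss most blocks; on a
missed block the weight cannot change without an error, so the successful points that agree off the
block lie in one layer of a `2 * k`-cube, a fraction at most `k.centralBinom / 4 ^ k`. Therefore a
fixed chain succeeds with arbitrarily small probability, hence with probability zero, and there are
only countably many chains. -/

theorem Gate.apply_sub {n : ℕ} (A : BitLanguage) (g : Gate n) (ψ ψ' : QState n) :
    g.apply A (ψ - ψ') = g.apply A ψ - g.apply A ψ' := by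
  cases g <;> ext z <;> simp [Gate.apply] <;> split_ifs <;> ring

/-- Adding `b z` to the target bit. -/
def addTo {n : ℕ} (t : Fin n) (b : (Fin n → Bool) → Bool) (z : Fin n → Bool) : Fin n → Bool :=
  Function.update z t (xor (z t) (b z))

theorem addTo_involutive {n : ℕ} (t : Fin n) (b : (Fin n → Bool) → Bool)
    (hb : ∀ z c, b (Function.update z t c) = b z) : Function.Involutive (addTo t b) := by
  intro z
  unfold addTo
  rw [hb]
  simp

theorem map_update_of_notMem {n : ℕ} (wires : List (Fin n)) (t : Fin n) (h : t ∉ wires)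
    (z : Fin n → Bool) (c : Bool) : wires.map (Function.update z t c) = wires.map z := by
  apply List.map_congr_left
  intro a ha
  rw [Function.update_of_ne]
  rintro rfl
  exact h ha

theorem sum_comp_addTo {n : ℕ} (t : Fin n) (b : (Fin n → Bool) → Bool)
    (hb : ∀ z c, b (Function.update z t c) = b z) (f : (Fin n → Bool) → ℝ) :
    ∑ z, f (addTo t b z) = ∑ z, f z :=
  Equiv.sum_comp (addTo_involutive t b hb).toPerm f

theorem Gate.norm_apply {n : ℕ} (A : BitLanguage) (g : Gate n) (ψ : QState n) :
    ‖g.apply A ψ‖ = ‖ψ‖ := by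
  rw [← sq_eq_sq₀ (norm_nonneg _) (norm_nonneg _), EuclideanSpace.norm_sq_eq,
    EuclideanSpace.norm_sq_eq]
  cases g with
  | hadamard i =>
    have key := sum_comp_addTo i (fun _ => true) (fun _ _ => rfl)
    -- The Hadamard gate mixes `z` only with its flip in bit `i`. Summing over such pairs counts
    -- everything twice, and on a pair the claim is the parallelogram law.
    suffices h : ∑ z, (‖(Gate.hadamard i).apply A ψ z‖ ^ 2 +
        ‖(Gate.hadamard i).apply A ψ (addTo i (fun _ => true) z)‖ ^ 2) =
        ∑ z, (‖ψ z‖ ^ 2 + ‖ψ (addTo i (fun _ => true) z)‖ ^ 2) by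
      rw [Finset.sum_add_distrib, Finset.sum_add_distrib,
        key (fun z => ‖(Gate.hadamard i).apply A ψ z‖ ^ 2), key (fun z => ‖ψ z‖ ^ 2)] at h
      linarith
    refine Finset.sum_congr rfl fun z _ => ?_
    have par := parallelogram_law_with_norm ℂ (ψ (Function.update z i false))
      (ψ (Function.update z i true))
    have hs : ‖((Real.sqrt 2 : ℝ) : ℂ)⁻¹‖ ^ 2 = 1 / 2 := by
      rw [norm_inv, Complex.norm_real, inv_pow, Real.norm_eq_abs, sq_abs]
      norm_num
    cases hz : z i
    · have h0 : Function.update z i false = z := by rw [← hz]; simp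
      simp only [Gate.apply, addTo, hz, Function.update_idem, Function.update_self, norm_mul,
        mul_pow, hs, h0] at par ⊢
      simp only [Bool.false_eq_true, if_false, if_true, Bool.false_xor, one_mul, neg_mul,
        ← sub_eq_add_neg]
      nlinarith [par]
    · have h0 : Function.update z i true = z := by rw [← hz]; simp
      simp only [Gate.apply, addTo, hz, Function.update_idem, Function.update_self, norm_mul,
        mul_pow, hs, h0] at par ⊢
      simp only [Bool.false_eq_true, if_false, if_true, Bool.true_xor, Bool.not_true, one_mul,
        neg_mul, ← sub_eq_add_neg]
      nlinarith [par]
  | phase i =>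
    refine Finset.sum_congr rfl fun z _ => ?_
    simp only [Gate.apply]
    split_ifs <;> simp
  | toffoli i j t h =>
    refine sum_comp_addTo t (fun z => z i && z j) (fun z c => ?_) (fun z => ‖ψ z‖ ^ 2)
    simp only [List.nodup_cons, List.mem_cons, List.not_mem_nil, or_false, not_or] at h
    rw [Function.update_of_ne h.1.2, Function.update_of_ne h.2.1]
  | oracle wires t h =>
    refine sum_comp_addTo t (fun z => A (wires.map z)) (fun z c => ?_) (fun z => ‖ψ z‖ ^ 2)
    rw [map_update_of_notMem wires t (List.nodup_cons.1 h).1]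

/-! ## Query weights and the hybrid argument -/

/-- The weight with which a gate, applied to `ψ`, queries the string `q`. -/
noncomputable def Gate.queryWeight {n : ℕ} (ψ : QState n) (q : List Bool) : Gate n → ℝ
  | .oracle wires _ _ => ∑ z, if wires.map z = q then ‖ψ z‖ ^ 2 else 0
  | _ => 0

/-- The number of wires on which a gate asks the oracle. -/
def Gate.arity {n : ℕ} : Gate n → ℕ
  | .oracle wires _ _ => wires.length
  | _ => 0

theorem Gate.queryWeight_nonneg {n : ℕ} (ψ : QState n) (q : List Bool) (g : Gate n) :
    0 ≤ g.queryWeight ψ q := by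
  cases g <;> simp only [Gate.queryWeight, le_refl]
  refine Finset.sum_nonneg fun z _ => ?_
  split_ifs <;> positivity

theorem Gate.sum_queryWeight_le {n : ℕ} (ψ : QState n) (g : Gate n) (S : Finset (List Bool)) :
    ∑ q ∈ S, g.queryWeight ψ q ≤ ‖ψ‖ ^ 2 := by
  cases g with
  | oracle wires t h =>
    simp only [Gate.queryWeight]
    rw [Finset.sum_comm, EuclideanSpace.norm_sq_eq]
    refine Finset.sum_le_sum fun z _ => ?_
    rw [Finset.sum_ite_eq]
    split_ifs
    · exact le_rfl
    · positivity
  | _ => simp [Gate.queryWeight]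

/-- Where the oracles differ, the two images have the amplitudes at `z` and at its target flip in
opposite order. With `‖a - b‖ ^ 2 ≤ 2 * ‖a‖ ^ 2 + 2 * ‖b‖ ^ 2`, and since the flip does not change
the query, each amplitude is counted with the constant `4`. The set `S` only serves to make the sum
over queries finite. -/
theorem Gate.norm_apply_sub_apply_sq_le {n : ℕ} (A A' : BitLanguage) (g : Gate n) (ψ : QState n)
    (S : Finset (List Bool)) (hS : ∀ q : List Bool, q.length ≤ g.arity → q ∈ S) :
    ‖g.apply A ψ - g.apply A' ψ‖ ^ 2 ≤ 4 * ∑ q ∈ S with A q ≠ A' q, g.queryWeight ψ q := by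
  cases g with
  | oracle wires t h =>
    have ht := (List.nodup_cons.1 h).1
    simp only [Gate.queryWeight]
    rw [Finset.sum_comm, EuclideanSpace.norm_sq_eq]
    have e : ∀ z, (∑ q ∈ S with A q ≠ A' q, if wires.map z = q then ‖ψ z‖ ^ 2 else 0) =
        if A (wires.map z) ≠ A' (wires.map z) then ‖ψ z‖ ^ 2 else 0 := by
      intro z
      rw [Finset.sum_ite_eq]
      have : wires.map z ∈ S := hS _ (by simp [Gate.arity])
      simp [this]
    simp only [e]
    have inv : ∑ z, (fun z => if A (wires.map z) ≠ A' (wires.map z) then ‖ψ z‖ ^ 2 else 0)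
        (addTo t (fun _ => true) z) = _ := sum_comp_addTo t (fun _ => true) (fun _ _ => rfl)
          (fun z => if A (wires.map z) ≠ A' (wires.map z) then ‖ψ z‖ ^ 2 else 0)
    have : (4 : ℝ) * ∑ z, (if A (wires.map z) ≠ A' (wires.map z) then ‖ψ z‖ ^ 2 else 0) =
        ∑ z, (2 * (if A (wires.map z) ≠ A' (wires.map z) then ‖ψ z‖ ^ 2 else 0) +
          2 * (fun z => if A (wires.map z) ≠ A' (wires.map z) then ‖ψ z‖ ^ 2 else 0)
            (addTo t (fun _ => true) z)) := by
      rw [Finset.sum_add_distrib, ← Finset.mul_sum, ← Finset.mul_sum, inv]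
      ring
    rw [this]
    refine Finset.sum_le_sum fun z _ => ?_
    simp only [addTo, map_update_of_notMem wires t ht]
    simp only [Gate.apply, PiLp.sub_apply]
    by_cases hA : A (wires.map z) = A' (wires.map z)
    · simp [hA]
    · simp only [ne_eq, hA, not_false_eq_true, if_true]
      have tri : ∀ a b : ℂ, ‖a - b‖ ^ 2 ≤ 2 * ‖a‖ ^ 2 + 2 * ‖b‖ ^ 2 := by
        intro a b
        have h1 := norm_sub_le a b
        have h2 := norm_nonneg (a - b)
        nlinarith [sq_nonneg (‖a‖ - ‖b‖)]
      cases h1 : A (wires.map z) <;> cases h2 : A' (wires.map z)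
      · simp [h1, h2] at hA
      · simpa using tri (ψ z) (ψ (Function.update z t (!z t)))
      · have := tri (ψ (Function.update z t (!z t))) (ψ z)
        simp only [Bool.xor_true, Bool.xor_false, Function.update_eq_self]
        linarith
      · simp [h1, h2] at hA
  | _ => simp [Gate.apply, Gate.queryWeight]

/-- The state after a list of gates. -/
noncomputable def runGates {n : ℕ} (A : BitLanguage) (gs : List (Gate n)) (ψ : QState n) :
    QState n :=
  gs.foldl (fun ψ g => g.apply A ψ) ψ

theorem norm_runGates {n : ℕ} (A : BitLanguage) (gs : List (Gate n)) (ψ : QState n) :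
    ‖runGates A gs ψ‖ = ‖ψ‖ := by
  induction gs generalizing ψ with
  | nil => rfl
  | cons g gs ih => exact (ih _).trans (g.norm_apply A ψ)

/-- The total weight with which a list of gates queries the string `q`. -/
noncomputable def gatesQueryWeight {n : ℕ} (A : BitLanguage) (q : List Bool) :
    List (Gate n) → QState n → ℝ
  | [], _ => 0
  | g :: gs, ψ => g.queryWeight ψ q + gatesQueryWeight A q gs (g.apply A ψ)

theorem gatesQueryWeight_nonneg {n : ℕ} (A : BitLanguage) (q : List Bool) (gs : List (Gate n))
    (ψ : QState n) : 0 ≤ gatesQueryWeight A q gs ψ := by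
  induction gs generalizing ψ with
  | nil => exact le_rfl
  | cons g gs ih => exact add_nonneg (g.queryWeight_nonneg ψ q) (ih _)

theorem sum_gatesQueryWeight_le {n : ℕ} (A : BitLanguage) (gs : List (Gate n)) (ψ : QState n)
    (hψ : ‖ψ‖ = 1) (S : Finset (List Bool)) :
    ∑ q ∈ S, gatesQueryWeight A q gs ψ ≤ gs.length := by
  induction gs generalizing ψ with
  | nil => simp [gatesQueryWeight]
  | cons g gs ih =>
    simp only [gatesQueryWeight, Finset.sum_add_distrib, List.length_cons, Nat.cast_add,
      Nat.cast_one]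
    have h1 := g.sum_queryWeight_le ψ S
    have h2 := ih (g.apply A ψ) ((g.norm_apply A ψ).trans hψ)
    rw [hψ] at h1
    linarith

/-- Gates are isometries, so the errors of single gates add up, and the weights are those of the run
with `A` alone. One gate contributes at most `2 * √W ≤ η + W / η`; the free parameter `η` replaces a
Cauchy–Schwarz inequality over the gates. -/
theorem norm_runGates_sub_le {n : ℕ} (A A' : BitLanguage) (S : Finset (List Bool))
    (η : ℝ) (hη : 0 < η) (gs : List (Gate n))
    (hS : ∀ g ∈ gs, ∀ q : List Bool, q.length ≤ g.arity → q ∈ S) (ψ ψ' : QState n) :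
    ‖runGates A gs ψ - runGates A' gs ψ'‖ ≤ ‖ψ - ψ'‖ + gs.length * η +
      (∑ q ∈ S with A q ≠ A' q, gatesQueryWeight A q gs ψ) / η := by
  induction gs generalizing ψ ψ' with
  | nil => simp [runGates, gatesQueryWeight]
  | cons g gs ih =>
    have h1 := ih (fun g' hg' => hS g' (List.mem_cons_of_mem _ hg')) (g.apply A ψ) (g.apply A' ψ')
    have h2 : ‖g.apply A ψ - g.apply A' ψ'‖ ≤ ‖g.apply A ψ - g.apply A' ψ‖ + ‖ψ - ψ'‖ := by
      rw [← g.norm_apply A' (ψ - ψ'), Gate.apply_sub]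
      exact norm_sub_le_norm_sub_add_norm_sub _ _ _
    have h3 := g.norm_apply_sub_apply_sq_le A A' ψ S (hS g List.mem_cons_self)
    set W := ∑ q ∈ S with A q ≠ A' q, g.queryWeight ψ q with hW
    have h4 : ‖g.apply A ψ - g.apply A' ψ‖ ≤ η + W / η := by
      have hn := norm_nonneg (g.apply A ψ - g.apply A' ψ)
      have : ‖g.apply A ψ - g.apply A' ψ‖ * η ≤ η * η + W := by
        nlinarith [sq_nonneg (‖g.apply A ψ - g.apply A' ψ‖ - 2 * η)]
      rw [← sub_le_iff_le_add', le_div_iff₀ hη]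
      linarith
    simp only [gatesQueryWeight, Finset.sum_add_distrib, List.length_cons, Nat.cast_add,
      Nat.cast_one, add_div, ← hW]
    change ‖runGates A gs (g.apply A ψ) - runGates A' gs (g.apply A' ψ')‖ ≤ _
    linarith

/-! ### From distances of states to acceptance probabilities -/

theorem Circuit.norm_initState (C : Circuit) (φ : QState C.witness) : ‖C.initState φ‖ = ‖φ‖ := by
  rw [← sq_eq_sq₀ (norm_nonneg _) (norm_nonneg _), EuclideanSpace.norm_sq_eq,
    EuclideanSpace.norm_sq_eq]
  symm
  refine Finset.sum_of_injOn (fun w => Fin.append w (fun _ => false)) ?_ ?_ ?_ ?_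
  · intro w _ w' _ h
    funext i
    simpa using congrFun h (Fin.castAdd _ i)
  · simp
  · intro z _ hz
    simp only [Circuit.initState]
    rw [if_neg]
    · simp
    · intro h
      refine hz ⟨fun i => z (Fin.castAdd C.ancilla i), by simp, ?_⟩
      funext i
      refine Fin.addCases (fun i => ?_) (fun j => ?_) i
      · simp
      · simp [h j]
  · intro w _
    simp [Circuit.initState]

theorem Circuit.finalState_eq (C : Circuit) (A : BitLanguage) (φ : QState C.witness) :
    C.finalState A φ = runGates A C.gates (C.initState φ) := rfl

theorem Circuit.norm_finalState (C : Circuit) (A : BitLanguage) (φ : QState C.witness) :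
    ‖C.finalState A φ‖ = ‖φ‖ := by
  rw [C.finalState_eq, norm_runGates, C.norm_initState]

/-- Each sum is the squared norm of a coordinate projection `P`. The difference of squares factors;
one factor is at most `2` because the states are unit vectors, the other at most `‖ψ - ψ'‖` because
`P` is a contraction. -/
theorem sum_norm_sq_sub_le {n : ℕ} (p : (Fin n → Bool) → Prop) [DecidablePred p] (ψ ψ' : QState n)
    (h : ‖ψ‖ = 1) (h' : ‖ψ'‖ = 1) :
    (∑ z, if p z then ‖ψ z‖ ^ 2 else 0) - (∑ z, if p z then ‖ψ' z‖ ^ 2 else 0) ≤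
      2 * ‖ψ - ψ'‖ := by
  let P : QState n → QState n := fun ψ => WithLp.toLp 2 fun z => if p z then ψ z else 0
  have hP : ∀ ψ, (∑ z, if p z then ‖ψ z‖ ^ 2 else 0) = ‖P ψ‖ ^ 2 := by
    intro ψ
    rw [EuclideanSpace.norm_sq_eq]
    refine Finset.sum_congr rfl fun z _ => ?_
    simp only [P]
    split_ifs <;> simp
  have hle : ∀ ψ, ‖P ψ‖ ≤ ‖ψ‖ := by
    intro ψ
    rw [← sq_le_sq₀ (norm_nonneg _) (norm_nonneg _), ← hP, EuclideanSpace.norm_sq_eq]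
    refine Finset.sum_le_sum fun z _ => ?_
    split_ifs <;> simp
  have hsub : P ψ - P ψ' = P (ψ - ψ') := by
    ext z
    simp only [P, PiLp.sub_apply]
    split_ifs <;> simp
  have h1 : ‖P ψ‖ - ‖P ψ'‖ ≤ ‖ψ - ψ'‖ :=
    (norm_sub_norm_le _ _).trans (hsub ▸ hle _)
  have h2 := hle ψ
  have h3 := hle ψ'
  rw [hP, hP]
  rw [h] at h2
  rw [h'] at h3
  nlinarith [norm_nonneg (P ψ), norm_nonneg (P ψ'), norm_nonneg (ψ - ψ')]

/-- The hybrid argument: if a witness makes a circuit accept with the oracle `A`, then the queries of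
the circuit put weight on the strings at which another oracle differs from `A`, unless the witness
makes the circuit accept with probability more than `1 / 3` with this oracle, too. -/
theorem Circuit.exists_queryWeight (C : Circuit) (T : ℕ) (hT : 0 < T) (hlen : C.gates.length ≤ T)
    (S : Finset (List Bool)) (hS : ∀ g ∈ C.gates, ∀ q : List Bool, q.length ≤ g.arity → q ∈ S)
    (A : BitLanguage) (φ : QState C.witness) (hφ : ‖φ‖ = 1) (hacc : 2 / 3 ≤ C.acceptProb A φ) :
    ∃ w : List Bool → ℝ, (∀ q, 0 ≤ w q) ∧ ∑ q ∈ S, w q ≤ T ∧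
      ∀ A' : BitLanguage, ∑ q ∈ S with A q ≠ A' q, w q < 1 / (144 * T) →
        1 / 3 < C.acceptProb A' φ := by
  have hT' : (0 : ℝ) < T := by exact_mod_cast hT
  have hlen' : (C.gates.length : ℝ) ≤ T := by exact_mod_cast hlen
  refine ⟨fun q => gatesQueryWeight A q C.gates (C.initState φ),
    fun q => gatesQueryWeight_nonneg _ _ _ _, ?_, fun A' hA' => ?_⟩
  · exact (sum_gatesQueryWeight_le A C.gates _ ((C.norm_initState φ).trans hφ) S).trans hlen'
  -- With `η = 1 / (12 * T)` and query weight below `1 / (144 * T)`, both error terms are at most `1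
  -- / 12`, the second strictly less. The states are at distance below `1 / 6`, so the acceptance
  -- probability drops by less than `1 / 3`.
  · have h1 := norm_runGates_sub_le A A' S (1 / (12 * T)) (by positivity) C.gates hS
      (C.initState φ) (C.initState φ)
    rw [← C.finalState_eq, ← C.finalState_eq, sub_self, norm_zero, zero_add] at h1
    have h2 := sum_norm_sq_sub_le (fun z => z C.out = true) (C.finalState A φ) (C.finalState A' φ)
      ((C.norm_finalState A φ).trans hφ) ((C.norm_finalState A' φ).trans hφ)
    change C.acceptProb A φ - C.acceptProb A' φ ≤ _ at h2
    have h3 : (C.gates.length : ℝ) * (1 / (12 * T)) ≤ 1 / 12 := by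
      rw [mul_one_div, div_le_div_iff₀ (by positivity) (by positivity)]
      linarith
    have h4 : (∑ q ∈ S with A q ≠ A' q, gatesQueryWeight A q C.gates (C.initState φ)) /
        (1 / (12 * T)) < 1 / 12 := by
      rw [div_lt_iff₀ (by positivity)]
      refine hA'.trans_eq ?_
      field_simp
      norm_num
    linarith

theorem runGates_congr {n : ℕ} (A A' : BitLanguage) (gs : List (Gate n))
    (h : ∀ g ∈ gs, ∀ q : List Bool, q.length ≤ g.arity → A q = A' q) (ψ : QState n) :
    runGates A gs ψ = runGates A' gs ψ := by
  induction gs generalizing ψ with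
  | nil => rfl
  | cons g gs ih =>
    have : g.apply A ψ = g.apply A' ψ := by
      cases g with
      | oracle wires t hd =>
        have := h _ List.mem_cons_self
        simp only [Gate.arity] at this
        simp only [Gate.apply]
        congr 1
        funext z
        rw [this _ (by simp)]
      | _ => rfl
    change runGates A gs (g.apply A ψ) = runGates A' gs (g.apply A' ψ)
    rw [this]
    exact ih (fun g' hg' => h g' (List.mem_cons_of_mem _ hg')) _

theorem Circuit.acceptProb_congr (C : Circuit) (A A' : BitLanguage)
    (h : ∀ g ∈ C.gates, ∀ q : List Bool, q.length ≤ g.arity → A q = A' q)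
    (φ : QState C.witness) : C.acceptProb A φ = C.acceptProb A' φ := by
  unfold Circuit.acceptProb
  rw [C.finalState_eq, C.finalState_eq, runGates_congr A A' _ h]

/-! ## Random restrictions of functions on the cube -/

section Restriction

variable {B : Type*}

/-- On the subcube through `x` in the directions of `R`, the value of `f` at `x` is certified by at
most `s` of the coordinates in `R`. -/
def HasCert (f : (B → Bool) → Bool) (R : Finset B) (x : B → Bool) (s : ℕ) : Prop :=
  ∃ C ⊆ R, C.card ≤ s ∧ ∀ x' : B → Bool, (∀ v, v ∉ R ∨ v ∈ C → x' v = x v) → f x' = f x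

/-! ### Formulas in disjunctive normal form and the switching lemma -/

/-- A term demands agreement with a given point on a given set of coordinates. -/
abbrev Term (B : Type*) : Type _ := (B → Bool) × Finset B

/-- The point `x` satisfies one of the terms. -/
def EvalDNF (F : List (Term B)) (x : B → Bool) : Prop := ∃ t ∈ F, ∀ v ∈ t.2, x v = t.1 v

variable [DecidableEq B]

open Classical in
/-- The free coordinates of the first term that is not falsified off `R` are queried, and so on until
a term is satisfied off the remaining free coordinates. The point is changed so that the
terms found are satisfied; the free coordinates that remain and the number of queries are
recorded. -/
noncomputable def encodeDNF : List (Term B) → (B → Bool) → Finset B → (B → Bool) × Finset B × ℕ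
  | [], x, R => (x, R, 0)
  | t :: F, x, R =>
    if ∃ v ∈ t.2 \ R, x v ≠ t.1 v then encodeDNF F x R
    else if t.2 ∩ R = ∅ then (x, R, 0)
    else
      ((fun v => if v ∈ t.2 ∩ R then t.1 v else (encodeDNF F x (R \ t.2)).1 v),
        (encodeDNF F x (R \ t.2)).2.1, (encodeDNF F x (R \ t.2)).2.2 + (t.2 ∩ R).card)

theorem encodeDNF_subset (F : List (Term B)) (x : B → Bool) (R : Finset B) :
    (encodeDNF F x R).2.1 ⊆ R := by
  induction F generalizing R with
  | nil => exact subset_rfl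
  | cons t F ih =>
    rw [encodeDNF]
    split_ifs
    · exact ih R
    · exact subset_rfl
    · exact (ih _).trans Finset.sdiff_subset

theorem encodeDNF_apply (F : List (Term B)) (x : B → Bool) (R : Finset B) (v : B) (hv : v ∉ R) :
    (encodeDNF F x R).1 v = x v := by
  induction F generalizing R with
  | nil => rfl
  | cons t F ih =>
    rw [encodeDNF]
    split_ifs
    · exact ih R hv
    · rfl
    · simp only
      rw [if_neg (by simp [hv]), ih _ (by simp [hv])]

/-- Every query costs one free coordinate. In the switching lemma this loss makes the restriction
after the queries far more likely than the one before. -/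
theorem encodeDNF_card (F : List (Term B)) (x : B → Bool) (R : Finset B) :
    (encodeDNF F x R).2.1.card + (encodeDNF F x R).2.2 = R.card := by
  induction F generalizing R with
  | nil => rfl
  | cons t F ih =>
    rw [encodeDNF]
    split_ifs
    · exact ih R
    · rfl
    · simp only
      rw [← add_assoc, ih, Finset.inter_comm]
      exact Finset.card_sdiff_add_card_inter R t.2

/-- The queried coordinates are the certificate. The search reads the original point, not the
modified one: skipped terms stay false, queried terms keep their value, and a term at which the
search stops stays true. -/
theorem exists_cert_encodeDNF (F : List (Term B)) (x : B → Bool) (R : Finset B) :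
    ∃ C ⊆ R, C.card ≤ (encodeDNF F x R).2.2 ∧
      ∀ x' : B → Bool, (∀ v, v ∉ R ∨ v ∈ C → x' v = x v) → (EvalDNF F x' ↔ EvalDNF F x) := by
  induction F generalizing R with
  | nil => exact ⟨∅, Finset.empty_subset _, by simp, fun x' _ => by simp [EvalDNF]⟩
  | cons t F ih =>
    have hcons : ∀ x, EvalDNF (t :: F) x ↔ (∀ v ∈ t.2, x v = t.1 v) ∨ EvalDNF F x := by
      intro x
      simp [EvalDNF]
    simp only [hcons]
    rw [encodeDNF]
    split_ifs with h1 h2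
    · obtain ⟨C, hC, hcard, h⟩ := ih R
      refine ⟨C, hC, hcard, fun x' hx' => ?_⟩
      obtain ⟨v, hv, hne⟩ := h1
      rw [Finset.mem_sdiff] at hv
      have e1 : ¬∀ v ∈ t.2, x v = t.1 v := fun h => hne (h v hv.1)
      have e2 : ¬∀ v ∈ t.2, x' v = t.1 v := fun h => hne (hx' v (Or.inl hv.2) ▸ h v hv.1)
      simp only [e1, e2, false_or, h x' hx']
    · refine ⟨∅, Finset.empty_subset _, by simp, fun x' hx' => ?_⟩
      push Not at h1
      have hR : ∀ v ∈ t.2, v ∉ R := fun v hv hvR =>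
        Finset.notMem_empty v (h2 ▸ Finset.mem_inter.2 ⟨hv, hvR⟩)
      have e1 : ∀ v ∈ t.2, x v = t.1 v := fun v hv => h1 v (Finset.mem_sdiff.2 ⟨hv, hR v hv⟩)
      have e2 : ∀ v ∈ t.2, x' v = t.1 v := fun v hv => (hx' v (Or.inl (hR v hv))).trans (e1 v hv)
      exact ⟨fun _ => Or.inl e1, fun _ => Or.inl e2⟩
    · obtain ⟨C, hC, hcard, h⟩ := ih (R \ t.2)
      refine ⟨C ∪ (t.2 ∩ R), Finset.union_subset (hC.trans Finset.sdiff_subset)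
        Finset.inter_subset_right, (Finset.card_union_le _ _).trans (by simpa using hcard),
        fun x' hx' => ?_⟩
      have ht : ∀ v ∈ t.2, x' v = x v := fun v hv => hx' v (by
        by_cases hvR : v ∈ R
        · exact Or.inr (Finset.mem_union_right _ (Finset.mem_inter.2 ⟨hv, hvR⟩))
        · exact Or.inl hvR)
      have e : (∀ v ∈ t.2, x' v = t.1 v) ↔ ∀ v ∈ t.2, x v = t.1 v :=
        forall₂_congr fun v hv => by rw [ht v hv]
      rw [e, h x']
      intro v hv
      by_cases hvt : v ∈ t.2
      · exact ht v hvt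
      · refine hx' v ?_
        simp only [Finset.mem_sdiff, not_and, not_not, Finset.mem_union] at hv ⊢
        tauto

variable [Fintype B]

-- Decoding, by induction on the formula. A preimage of `(x', R')` that stops at the first term is
-- `(x', R')` itself, with weight `1`. One that queries the first term is determined by the nonempty
-- set `V` of queried coordinates, the set `W` of ones of `x` on `V`, and a preimage under the
-- remaining formula; this gives at most `∑ 2 ^ |V| * ν ^ |V| * 2 ≤ 2 * ((1 + 2 * ν) ^ w - 1) ≤ 1`.
-- The total `2` reproduces the induction hypothesis.
open Classical in
theorem sum_fiber_encodeDNF_le (F : List (Term B)) (U : Finset B) (w : ℕ)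
    (hF : ∀ t ∈ F, (t.2 ∩ U).card ≤ w) (ν : ℝ) (hν0 : 0 ≤ ν) (hν : (1 + 2 * ν) ^ w ≤ 3 / 2)
    (x' : B → Bool) (R' : Finset B) :
    ∑ x, ∑ R ∈ U.powerset, (if (encodeDNF F x R).1 = x' ∧ (encodeDNF F x R).2.1 = R' then
      ν ^ (encodeDNF F x R).2.2 else 0) ≤ 2 := by
  have hsingle : ∑ x : B → Bool, ∑ R ∈ U.powerset, (if x = x' ∧ R = R' then (1 : ℝ) else 0) ≤ 1 := by
    rw [Finset.sum_eq_single x' (fun x _ hx => by simp [hx]) (by simp)]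
    simp only [true_and, Finset.sum_ite_eq']
    split_ifs <;> norm_num
  induction F generalizing x' R' with
  | nil =>
    simp only [encodeDNF, pow_zero]
    linarith
  | cons t F ih =>
    replace ih := ih (fun t' ht' => hF t' (List.mem_cons_of_mem _ ht'))
    set h : (B → Bool) → Finset B → (B → Bool) → Finset B → ℝ := fun x' R' x R =>
      if (encodeDNF F x R).1 = x' ∧ (encodeDNF F x R).2.1 = R' then
        ν ^ (encodeDNF F x R).2.2 else 0 with hh
    have h0 : ∀ x' R' x R, 0 ≤ h x' R' x R := by
      intro x' R' x R
      simp only [hh]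
      split_ifs <;> positivity
    -- Whether the search skipped `t` can be read off the image: stopping at `t` or querying it
    -- leaves `x'` in agreement with `t` off `R'`.
    by_cases bad : ∃ v ∈ t.2 \ R', x' v ≠ t.1 v
    · refine le_trans (Finset.sum_le_sum fun x _ => Finset.sum_le_sum fun R _ => ?_) (ih x' R' hsingle)
      change _ ≤ h x' R' x R
      rw [encodeDNF]
      split_ifs with h1 h2 h3 h3 h4
      · simp only [hh, if_pos h2, le_refl]
      · exact h0 _ _ _ _
      · simp only at h3
        rw [h3.1, h3.2] at h1
        exact absurd bad h1
      · exact h0 _ _ _ _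
      · exfalso
        obtain ⟨v, hv, hne⟩ := bad
        rw [Finset.mem_sdiff] at hv
        rw [← h4.1] at hne
        simp only at hne
        split_ifs at hne with hvV
        · exact hne rfl
        · have hvR : v ∉ R := fun hvR => hvV (Finset.mem_inter.2 ⟨hv.1, hvR⟩)
          rw [encodeDNF_apply F x _ v (by simp [hvR])] at hne
          exact h1 ⟨v, Finset.mem_sdiff.2 ⟨hv.1, hvR⟩, hne⟩
      · exact h0 _ _ _ _
    -- `ov V W` undoes the overwriting on `V`: it restores the bits of `x` there, which are recorded
    -- by the set `W` of ones.
    · let ov : Finset B → Finset B → B → Bool := fun V W v => if v ∈ V then decide (v ∈ W) else x' v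
      let f : Finset B → Finset B → (B → Bool) → Finset B → ℝ := fun V W x R =>
        ν ^ V.card * if t.2 ∩ R = V ∧ V.filter (fun v => x v) = W then
          h (ov V W) R' x (R \ V) else 0
      have f0 : ∀ V W x R, 0 ≤ f V W x R := by
        intro V W x R
        simp only [f]
        split_ifs
        · exact mul_nonneg (by positivity) (h0 _ _ _ _)
        · simp
      have main : ∀ x : B → Bool, ∀ R ∈ U.powerset,
          (if (encodeDNF (t :: F) x R).1 = x' ∧ (encodeDNF (t :: F) x R).2.1 = R' then
            ν ^ (encodeDNF (t :: F) x R).2.2 else 0) ≤ (if x = x' ∧ R = R' then (1 : ℝ) else 0) +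
          ∑ V ∈ (t.2 ∩ U).powerset.erase ∅, ∑ W ∈ V.powerset, f V W x R := by
        intro x R hR
        have s0 : 0 ≤ ∑ V ∈ (t.2 ∩ U).powerset.erase ∅, ∑ W ∈ V.powerset, f V W x R :=
          Finset.sum_nonneg fun V _ => Finset.sum_nonneg fun W _ => f0 V W x R
        have s1 : 0 ≤ (if x = x' ∧ R = R' then (1 : ℝ) else 0) := by split_ifs <;> norm_num
        rw [encodeDNF]
        by_cases h1 : ∃ v ∈ t.2 \ R, x v ≠ t.1 v
        · rw [if_pos h1, if_neg]
          · exact add_nonneg s1 s0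
          · rintro ⟨e1, e2⟩
            obtain ⟨v, hv, hne⟩ := h1
            rw [Finset.mem_sdiff] at hv
            refine bad ⟨v, Finset.mem_sdiff.2 ⟨hv.1, fun hv' => hv.2 ?_⟩, ?_⟩
            · rw [← e2] at hv'
              exact encodeDNF_subset F x R hv'
            · rw [← e1, encodeDNF_apply F x R v hv.2]
              exact hne
        · rw [if_neg h1]
          by_cases h2 : t.2 ∩ R = ∅
          · rw [if_pos h2, pow_zero]
            simpa using s0
          · rw [if_neg h2]
            set V := t.2 ∩ R with hV
            have hRV : R \ t.2 = R \ V := by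
              ext v
              simp only [hV, Finset.mem_sdiff, Finset.mem_inter]
              tauto
            have m1 : V ∈ (t.2 ∩ U).powerset.erase ∅ := by
              rw [Finset.mem_erase, Finset.mem_powerset]
              exact ⟨h2, Finset.inter_subset_inter_left (Finset.mem_powerset.1 hR)⟩
            have m2 : V.filter (fun v => x v) ∈ V.powerset :=
              Finset.mem_powerset.2 (Finset.filter_subset _ _)
            have l2 := Finset.single_le_sum (f := fun W => f V W x R) (fun W _ => f0 V W x R) m2
            have l1 := Finset.single_le_sum (f := fun V => ∑ W ∈ V.powerset, f V W x R)
              (fun V _ => Finset.sum_nonneg fun W _ => f0 V W x R) m1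
            refine le_trans ?_ (le_add_of_nonneg_of_le s1 (l2.trans l1))
            simp only [f, ← hV, true_and, if_true, hh]
            split_ifs with h3 h4 h4
            · rw [hRV, pow_add, mul_comm]
            · refine absurd ⟨?_, hRV ▸ h3.2⟩ h4
              funext v
              have := congrFun h3.1 v
              simp only [ov]
              split_ifs with hv
              · rw [encodeDNF_apply F x _ v (by simp [hv])]
                simp [hv]
              · simpa [hv, hRV] using this
            · positivity
            · simp
      refine (Finset.sum_le_sum fun x _ => Finset.sum_le_sum fun R hR => main x R hR).trans ?_
      simp only [Finset.sum_add_distrib]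
      have step : ∀ V ∈ (t.2 ∩ U).powerset.erase ∅, ∀ W ∈ V.powerset,
          ∑ x, ∑ R ∈ U.powerset, f V W x R ≤ ν ^ V.card * 2 := by
        intro V _ W _
        simp only [f, ← Finset.mul_sum]
        refine mul_le_mul_of_nonneg_left (le_trans ?_ (ih (ov V W) R' ?_)) (by positivity)
        · refine Finset.sum_le_sum fun x _ => ?_
          change _ ≤ ∑ R ∈ U.powerset, h (ov V W) R' x R
          -- Once `V` is known to lie in `R`, the map `R ↦ R \ V` is injective, so the sum is part
          -- of the one in the induction hypothesis.
          calc ∑ R ∈ U.powerset, (if t.2 ∩ R = V ∧ V.filter (fun v => x v) = W then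
                  h (ov V W) R' x (R \ V) else 0)
              ≤ ∑ R ∈ U.powerset with t.2 ∩ R = V, h (ov V W) R' x (R \ V) := by
                rw [Finset.sum_filter]
                refine Finset.sum_le_sum fun R _ => ?_
                split_ifs with a1 a2 a2
                · exact le_rfl
                · exact absurd a1.1 a2
                · exact h0 _ _ _ _
                · exact le_rfl
            _ = ∑ R ∈ (U.powerset.filter fun R => t.2 ∩ R = V).image (· \ V),
                  h (ov V W) R' x R := by
                rw [Finset.sum_image]
                intro R1 h1 R2 h2 h12
                simp only [Finset.coe_filter, Set.mem_ofPred_eq] at h1 h2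
                have u1 : V ⊆ R1 := h1.2 ▸ Finset.inter_subset_right
                have u2 : V ⊆ R2 := h2.2 ▸ Finset.inter_subset_right
                rw [← Finset.sdiff_union_of_subset u1, ← Finset.sdiff_union_of_subset u2]
                exact congrArg (· ∪ V) h12
            _ ≤ ∑ R ∈ U.powerset, h (ov V W) R' x R := by
                refine Finset.sum_le_sum_of_subset_of_nonneg ?_ fun R _ _ => h0 _ _ _ _
                intro R hR
                obtain ⟨R1, h1, rfl⟩ := Finset.mem_image.1 hR
                rw [Finset.mem_filter, Finset.mem_powerset] at h1
                exact Finset.mem_powerset.2 (Finset.sdiff_subset.trans h1.1)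
        · rw [Finset.sum_eq_single (ov V W) (fun x _ hx => by simp [hx]) (by simp)]
          simp only [true_and, Finset.sum_ite_eq']
          split_ifs <;> norm_num
      have swap : ∑ x, ∑ R ∈ U.powerset, ∑ V ∈ (t.2 ∩ U).powerset.erase ∅, ∑ W ∈ V.powerset,
          f V W x R ≤ 1 := by
        calc _ = ∑ V ∈ (t.2 ∩ U).powerset.erase ∅, ∑ W ∈ V.powerset,
              ∑ x, ∑ R ∈ U.powerset, f V W x R := by
              rw [Finset.sum_congr rfl fun x _ => Finset.sum_comm, Finset.sum_comm]
              refine Finset.sum_congr rfl fun V _ => ?_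
              rw [Finset.sum_congr rfl fun x _ => Finset.sum_comm, Finset.sum_comm]
          _ ≤ ∑ V ∈ (t.2 ∩ U).powerset.erase ∅, ∑ W ∈ V.powerset, ν ^ V.card * 2 :=
              Finset.sum_le_sum fun V hV => Finset.sum_le_sum fun W hW => step V hV W hW
          _ = 2 * ∑ V ∈ (t.2 ∩ U).powerset.erase ∅, (2 * ν) ^ V.card := by
              rw [Finset.mul_sum]
              refine Finset.sum_congr rfl fun V _ => ?_
              rw [Finset.sum_const, Finset.card_powerset, mul_pow, nsmul_eq_mul]
              push_cast
              ring
          _ = 2 * ((1 + 2 * ν) ^ (t.2 ∩ U).card - 1) := by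
              rw [Finset.sum_erase_eq_sub (Finset.empty_mem_powerset _)]
              have := Finset.sum_pow_mul_eq_add_pow (2 * ν) 1 (t.2 ∩ U)
              simp only [one_pow, mul_one] at this
              rw [this, Finset.card_empty, pow_zero, add_comm]
          _ ≤ 1 := by
              have := (pow_le_pow_right₀ (by linarith : (1 : ℝ) ≤ 1 + 2 * ν)
                (hF t List.mem_cons_self)).trans hν
              linarith
      linarith

/-- If, for a random `q`-colouring of the coordinates, each colour class is bad for a random point
with small probability only, then a large colour class is bad for few points. -/
theorem exists_large_restriction (R : Finset B) (q : ℕ) (hq : 0 < q) (δ : ℝ)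
    (Bad : Finset B → (B → Bool) → Prop) [∀ R, DecidablePred (Bad R)]
    (h : ∀ j : Fin q, ((Finset.univ.filter fun p : (B → Bool) × (B → Fin q) =>
      Bad (R.filter fun v => p.2 v = j) p.1).card : ℝ) ≤
        δ * q ^ Fintype.card B * 2 ^ Fintype.card B) :
    ∃ R' ⊆ R, R.card ≤ q * R'.card ∧
      ((Finset.univ.filter fun x => Bad R' x).card : ℝ) ≤ q * δ * 2 ^ Fintype.card B := by
  have : Nonempty (Fin q) := ⟨⟨0, hq⟩⟩
  have hq' : (0 : ℝ) < q := by exact_mod_cast hq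
  -- Averaging yields one colouring whose classes are good all together, at the cost of a factor
  -- `q`. The colour is chosen only afterwards, as one that is frequent on `R`.
  have h1 : ∑ χ : B → Fin q, ∑ j : Fin q, ((Finset.univ.filter fun x : B → Bool =>
      Bad (R.filter fun v => χ v = j) x).card : ℝ) ≤
      ∑ _χ : B → Fin q, q * δ * 2 ^ Fintype.card B := by
    rw [Finset.sum_comm]
    have : ∀ j : Fin q, ∑ χ : B → Fin q, ((Finset.univ.filter fun x : B → Bool =>
        Bad (R.filter fun v => χ v = j) x).card : ℝ) ≤
        δ * q ^ Fintype.card B * 2 ^ Fintype.card B := by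
      intro j
      refine le_trans (le_of_eq ?_) (h j)
      simp only [Finset.card_filter, Nat.cast_sum]
      rw [Fintype.sum_prod_type_right]
    refine (Finset.sum_le_sum fun j _ => this j).trans (le_of_eq ?_)
    simp only [Finset.sum_const, Finset.card_univ, Fintype.card_fun, Fintype.card_fin, nsmul_eq_mul,
      Nat.cast_pow]
    ring
  obtain ⟨χ, -, hχ⟩ := Finset.exists_le_of_sum_le Finset.univ_nonempty h1
  have h2 : ∑ _j : Fin q, R.card ≤ ∑ j : Fin q, q * (R.filter fun v => χ v = j).card := by
    rw [← Finset.mul_sum, ← Finset.card_eq_sum_card_fiberwise (fun v _ => Finset.mem_coe.2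
      (Finset.mem_univ (χ v)))]
    simp
  obtain ⟨j, -, hj⟩ := Finset.exists_le_of_sum_le Finset.univ_nonempty h2
  refine ⟨R.filter fun v => χ v = j, Finset.filter_subset _ _, hj, le_trans ?_ hχ⟩
  exact Finset.single_le_sum (f := fun j => ((Finset.univ.filter fun x : B → Bool =>
      Bad (R.filter fun v => χ v = j) x).card : ℝ)) (fun _ _ => Nat.cast_nonneg _)
    (Finset.mem_univ j)

open Classical in
/-- A weight without heavy coordinates is unlikely to have much mass on a random colour class. -/
theorem card_coloring_weight_ge (R : Finset B) (ν : B → ℝ) (τ θ a : ℝ) (q : ℕ) (hq : 0 < q)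
    (hτ : 0 < τ) (hν : ∀ v ∈ R, 0 ≤ ν v ∧ ν v ≤ τ) (hsum : ∑ v ∈ R, ν v ≤ a)
    (hqa : 2 * a ≤ q * τ) (j : Fin q) :
    ((Finset.univ.filter fun χ : B → Fin q => θ ≤ ∑ v ∈ R with χ v = j, ν v).card : ℝ) ≤
      q ^ Fintype.card B * Real.exp (1 - θ / τ) := by
  have hq' : (0 : ℝ) < q := by exact_mod_cast hq
  -- A Chernoff bound: the exponential moment of the mass divided by `τ` factors over the
  -- coordinates. As `ν v / τ ≤ 1`, one has `exp u ≤ 1 + 2 * u` in each factor, and `2 * a ≤ q * τ`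
  -- bounds the normalised product by `exp 1`.
  let f : B → Fin q → ℝ := fun v c => if v ∈ R ∧ c = j then Real.exp (ν v / τ) else 1
  have hf : ∀ χ : B → Fin q, ∏ v, f v (χ v) = Real.exp ((∑ v ∈ R with χ v = j, ν v) / τ) := by
    intro χ
    rw [Finset.sum_div, Real.exp_sum, Finset.prod_filter, ← Finset.prod_filter_mul_prod_filter_not
      Finset.univ (· ∈ R)]
    rw [Finset.filter_mem_eq_inter, Finset.univ_inter, Finset.prod_congr rfl (g := fun v =>
      if χ v = j then Real.exp (ν v / τ) else 1), Finset.prod_congr (s₁ := Finset.univ.filter _) rfl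
      (g := fun _ => (1 : ℝ))]
    · simp
    · intro v hv
      simp only [Finset.mem_filter, Finset.mem_univ, true_and] at hv
      simp [f, hv]
    · intro v hv
      simp [f, hv]
  have h1 : ((Finset.univ.filter fun χ : B → Fin q =>
      θ ≤ ∑ v ∈ R with χ v = j, ν v).card : ℝ) * Real.exp (θ / τ) ≤
      ∑ χ : B → Fin q, ∏ v, f v (χ v) := by
    rw [Finset.card_filter, Nat.cast_sum, Finset.sum_mul]
    refine Finset.sum_le_sum fun χ _ => ?_
    rw [hf]
    split_ifs with hχ
    · rw [Nat.cast_one, one_mul, Real.exp_le_exp]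
      exact div_le_div_of_nonneg_right hχ hτ.le
    · simp [Real.exp_nonneg]
  have h2 : ∑ χ : B → Fin q, ∏ v, f v (χ v) = ∏ v, ∑ c, f v c := by
    rw [Finset.prod_univ_sum, Fintype.piFinset_univ]
  have h3 : ∀ v, ∑ c, f v c ≤ q * Real.exp (if v ∈ R then 2 * ν v / (τ * q) else 0) := by
    intro v
    by_cases hv : v ∈ R
    · have e : ∀ c, f v c = 1 + if c = j then Real.exp (ν v / τ) - 1 else 0 := by
        intro c
        simp only [f, hv, true_and]
        split_ifs <;> ring
      simp only [e, Finset.sum_add_distrib, Finset.sum_ite_eq', Finset.mem_univ, if_true, hv]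
      have u0 : 0 ≤ ν v / τ := div_nonneg (hν v hv).1 hτ.le
      have u1 : ν v / τ ≤ 1 := (div_le_one hτ).2 (hν v hv).2
      have u2 := Real.abs_exp_sub_one_sub_id_le (x := ν v / τ) (by rw [abs_of_nonneg u0]; exact u1)
      have u3 := (abs_le.1 u2).2
      have u4 := Real.add_one_le_exp (2 * ν v / (τ * q))
      have u5 : q * (2 * ν v / (τ * q)) = 2 * (ν v / τ) := by field_simp
      have u6 := mul_le_mul_of_nonneg_left u4 hq'.le
      simp only [Finset.sum_const, Finset.card_univ, Fintype.card_fin, nsmul_eq_mul, mul_one]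
      nlinarith
    · simp [f, hv]
  have h4 : ∏ v, ∑ c, f v c ≤ q ^ Fintype.card B * Real.exp 1 := by
    refine (Finset.prod_le_prod (fun v _ => Finset.sum_nonneg fun c _ => ?_)
      fun v _ => h3 v).trans ?_
    · simp only [f]
      split_ifs <;> positivity
    · rw [Finset.prod_mul_distrib, Finset.prod_const, Finset.card_univ, ← Real.exp_sum]
      refine mul_le_mul_of_nonneg_left (Real.exp_le_exp.2 ?_) (by positivity)
      rw [Finset.sum_ite_mem, Finset.univ_inter, ← Finset.sum_div, ← Finset.mul_sum,
        div_le_one (by positivity)]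
      nlinarith
  rw [Real.exp_sub, ← mul_div_assoc, le_div_iff₀ (Real.exp_pos _)]
  exact h1.trans (h2.trans_le h4)

end Restriction

/-! ### The switching lemma and the collapse of one level -/

section Collapse

variable {B : Type*} [DecidableEq B] [Fintype B]

/-- The colour is forced on `R`, must avoid `j` on `U \ R`, and is free off `U`. -/
theorem card_coloring_class (U R : Finset B) (hR : R ⊆ U) (q : ℕ) (j : Fin q) :
    (Finset.univ.filter fun χ : B → Fin q => (U.filter fun v => χ v = j) = R).card =
      (q - 1) ^ (U.card - R.card) * q ^ (Fintype.card B - U.card) := by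
  have e : (Finset.univ.filter fun χ : B → Fin q => (U.filter fun v => χ v = j) = R) =
      Fintype.piFinset fun v =>
        if v ∈ R then {j} else if v ∈ U then Finset.univ.erase j else Finset.univ := by
    ext χ
    simp only [Finset.mem_filter, Finset.mem_univ, true_and, Fintype.mem_piFinset, Finset.ext_iff]
    refine forall_congr' fun v => ?_
    have := @hR v
    split_ifs with h1 h2
    · simp [h1, this h1]
    · simp [h1, h2]
    · simp [h1, h2]
  rw [e, Fintype.card_piFinset, ← Finset.prod_mul_prod_compl U, ← Finset.prod_sdiff hR]
  rw [Finset.prod_congr rfl (g := fun _ => q - 1), Finset.prod_congr (s₁ := R) rfl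
    (g := fun _ => 1), Finset.prod_congr (s₁ := Uᶜ) rfl (g := fun _ => q)]
  · rw [Finset.prod_const, Finset.prod_const, Finset.prod_const, one_pow, mul_one,
      Finset.card_sdiff_of_subset hR, Finset.card_compl]
  · intro v hv
    rw [Finset.mem_compl] at hv
    rw [if_neg fun h => hv (hR h), if_neg hv]
    simp
  · intro v hv
    simp [hv]
  · intro v hv
    rw [Finset.mem_sdiff] at hv
    rw [if_neg hv.2, if_pos hv.1]
    simp

theorem one_add_pow_le_of_mul_le (w : ℕ) (hw : 0 < w) :
    (1 + 2 * (1 / (8 * w)) : ℝ) ^ w ≤ 3 / 2 := by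
  have hw' : (0 : ℝ) < w := by exact_mod_cast hw
  have h1 : (1 + 2 * (1 / (8 * w)) : ℝ) ≤ Real.exp (2 * (1 / (8 * w))) := by
    rw [add_comm]
    exact Real.add_one_le_exp _
  refine (pow_le_pow_left₀ (by positivity) h1 w).trans ?_
  rw [← Real.exp_nat_mul]
  have h2 : (w : ℝ) * (2 * (1 / (8 * w))) = 1 / 4 := by
    field_simp
    norm_num
  rw [h2]
  have := (abs_le.1 (Real.abs_exp_sub_one_sub_id_le (x := 1 / 4) (by norm_num [abs_le]))).2
  linarith

open Classical in
/-- The switching lemma, for the random restriction that frees a colour class. -/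
theorem card_switching (F : List (Term B)) (U : Finset B) (w : ℕ) (hw : 0 < w)
    (hF : ∀ t ∈ F, (t.2 ∩ U).card ≤ w) (s q : ℕ) (hq : q = 16 * w + 1) (j : Fin q) :
    ((Finset.univ.filter fun p : (B → Bool) × (B → Fin q) =>
      s ≤ (encodeDNF F p.1 (U.filter fun v => p.2 v = j)).2.2).card : ℝ) ≤
      2 / 2 ^ s * (q : ℝ) ^ Fintype.card B * 2 ^ Fintype.card B := by
  have hw' : (0 : ℝ) < w := by exact_mod_cast hw
  have hU : U.card ≤ Fintype.card B := Finset.card_le_univ U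
  set m : (B → Bool) → Finset B → ℕ := fun x R => (encodeDNF F x R).2.2 with hm
  have h1 : ((Finset.univ.filter fun p : (B → Bool) × (B → Fin q) =>
      s ≤ m p.1 (U.filter fun v => p.2 v = j)).card : ℝ) * 2 ^ s ≤
      ∑ x : B → Bool, ∑ χ : B → Fin q, (2 : ℝ) ^ m x (U.filter fun v => χ v = j) := by
    rw [Finset.card_filter, Nat.cast_sum, Finset.sum_mul, Fintype.sum_prod_type]
    refine Finset.sum_le_sum fun x _ => Finset.sum_le_sum fun χ _ => ?_
    split_ifs with h
    · rw [Nat.cast_one, one_mul]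
      exact pow_le_pow_right₀ one_le_two h
    · rw [Nat.cast_zero, zero_mul]
      positivity
  have h2 : ∀ x : B → Bool, ∑ χ : B → Fin q, (2 : ℝ) ^ m x (U.filter fun v => χ v = j) =
      (q : ℝ) ^ (Fintype.card B - U.card) *
        ∑ R ∈ U.powerset, (16 * w : ℝ) ^ (U.card - R.card) * 2 ^ m x R := by
    intro x
    rw [← Finset.sum_fiberwise_of_maps_to (s := Finset.univ) (t := U.powerset)
      (g := fun χ : B → Fin q => U.filter fun v => χ v = j)
      (fun χ _ => Finset.mem_powerset.2 (Finset.filter_subset _ _)), Finset.mul_sum]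
    refine Finset.sum_congr rfl fun R hR => ?_
    rw [Finset.sum_congr rfl (g := fun _ => (2 : ℝ) ^ m x R)]
    · rw [Finset.sum_const, card_coloring_class U R (Finset.mem_powerset.1 hR), nsmul_eq_mul]
      simp only [hq, Nat.add_sub_cancel]
      push_cast
      ring
    · intro χ hχ
      rw [(Finset.mem_filter.1 hχ).2]
  -- The terms are sorted by the image of the encoding. Since the image has `m x R` fewer free
  -- coordinates, its weight is larger by the factor `(16 * w) ^ m x R`, and `(16 * w) * (1 / (8 *
  -- w)) = 2` accounts for `2 ^ m x R`. So the fibre bound applies with `ν = 1 / (8 * w)`, and the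
  -- remaining sum over `R'` is binomial with value `q ^ U.card`.
  have h3 : ∀ (x : B → Bool), ∀ R ∈ U.powerset,
      (16 * w : ℝ) ^ (U.card - R.card) * 2 ^ m x R = ∑ x' : B → Bool, ∑ R' ∈ U.powerset,
        (16 * w : ℝ) ^ (U.card - R'.card) *
          if (encodeDNF F x R).1 = x' ∧ (encodeDNF F x R).2.1 = R' then
            (1 / (8 * w) : ℝ) ^ m x R else 0 := by
    intro x R hR
    rw [Finset.mem_powerset] at hR
    have hsub := (encodeDNF_subset F x R).trans hR
    rw [Finset.sum_eq_single (encodeDNF F x R).1 (fun x' _ hx => by simp [hx.symm]) (by simp)]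
    rw [Finset.sum_eq_single (encodeDNF F x R).2.1 (fun x' _ hx => by simp [hx.symm])
      (fun h => absurd (Finset.mem_powerset.2 hsub) h)]
    rw [if_pos ⟨rfl, rfl⟩]
    have hc := encodeDNF_card F x R
    have hc' := Finset.card_le_card hR
    have : U.card - (encodeDNF F x R).2.1.card = U.card - R.card + m x R := by
      simp only [hm]
      omega
    rw [this, pow_add, mul_assoc, ← mul_pow]
    congr 2
    field_simp
    norm_num
  have h4 : ∑ x : B → Bool, ∑ R ∈ U.powerset, (16 * w : ℝ) ^ (U.card - R.card) * 2 ^ m x R ≤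
      2 ^ Fintype.card B * (q : ℝ) ^ U.card * 2 := by
    calc _ = ∑ x : B → Bool, ∑ R ∈ U.powerset, ∑ x' : B → Bool, ∑ R' ∈ U.powerset,
          (16 * w : ℝ) ^ (U.card - R'.card) *
          if (encodeDNF F x R).1 = x' ∧ (encodeDNF F x R).2.1 = R' then
            (1 / (8 * w) : ℝ) ^ m x R else 0 :=
          Finset.sum_congr rfl fun x _ => Finset.sum_congr rfl fun R hR => h3 x R hR
      _ = ∑ x' : B → Bool, ∑ R' ∈ U.powerset, (16 * w : ℝ) ^ (U.card - R'.card) *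
            ∑ x : B → Bool, ∑ R ∈ U.powerset,
          if (encodeDNF F x R).1 = x' ∧ (encodeDNF F x R).2.1 = R' then
            (1 / (8 * w) : ℝ) ^ m x R else 0 := by
          rw [Finset.sum_congr rfl fun x _ => Finset.sum_comm, Finset.sum_comm]
          refine Finset.sum_congr rfl fun x' _ => ?_
          rw [Finset.sum_congr rfl fun x _ => Finset.sum_comm, Finset.sum_comm]
          simp only [Finset.mul_sum]
      _ ≤ ∑ _x' : B → Bool, ∑ R' ∈ U.powerset, (16 * w : ℝ) ^ (U.card - R'.card) * 2 := by
          refine Finset.sum_le_sum fun x' _ => Finset.sum_le_sum fun R' _ => ?_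
          refine mul_le_mul_of_nonneg_left ?_ (by positivity)
          exact sum_fiber_encodeDNF_le F U w hF _ (by positivity) (one_add_pow_le_of_mul_le w hw)
            x' R'
      _ = _ := by
          have := Finset.sum_pow_mul_eq_add_pow (1 : ℝ) (16 * w) U
          simp only [one_pow, one_mul] at this
          rw [Finset.sum_const, ← Finset.sum_mul, this, hq]
          simp only [Finset.card_univ, Fintype.card_fun, Fintype.card_bool, nsmul_eq_mul]
          push_cast
          ring
  have h5 : (q : ℝ) ^ (Fintype.card B - U.card) * (q : ℝ) ^ U.card = (q : ℝ) ^ Fintype.card B := by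
    rw [← pow_add, Nat.sub_add_cancel hU]
  simp only [h2, ← Finset.mul_sum] at h1
  have h6 := h1.trans (mul_le_mul_of_nonneg_left h4 (by positivity))
  rw [div_mul_eq_mul_div, div_mul_eq_mul_div, le_div_iff₀ (by positivity)]
  refine h6.trans (le_of_eq ?_)
  rw [← h5]
  ring

open Classical in
/-- For many formulas of small width at once, a large set of free coordinates is such that the
restricted formulas have small certificates at most points. -/
theorem exists_restriction_hasCert {Y : Type*} (Ys : Finset Y) (U : Finset B)
    (F : Y → List (Term B)) (w : ℕ) (hw : 0 < w) (hF : ∀ y ∈ Ys, ∀ t ∈ F y, (t.2 ∩ U).card ≤ w)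
    (n e : ℕ) (he : 2 ^ n * Ys.card ≤ 2 ^ e) :
    ∃ R ⊆ U, U.card ≤ (16 * w + 1) * R.card ∧
      2 ^ n * (Finset.univ.filter fun x => ¬∀ y ∈ Ys,
        HasCert (fun x => decide (EvalDNF (F y) x)) R x (e + 1 + (16 * w + 1))).card ≤
          2 ^ Fintype.card B := by
  obtain ⟨q, hq⟩ : ∃ q, q = 16 * w + 1 := ⟨_, rfl⟩
  rw [← hq]
  -- In the depth `e + 1 + q`, the part `e` pays for the union over `Ys` and the factor `2 ^ n`, the
  -- `1` for the constant of the switching lemma, and `q ≤ 2 ^ q` for the number of colours.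
  obtain ⟨R, hRU, hcard, hbad⟩ := exists_large_restriction U q (by omega)
    (Ys.card * (2 / 2 ^ (e + 1 + q)))
    (fun R x => ¬∀ y ∈ Ys, (encodeDNF (F y) x R).2.2 < e + 1 + q) (by
      intro j
      have : (Finset.univ.filter fun p : (B → Bool) × (B → Fin q) => ¬∀ y ∈ Ys,
          (encodeDNF (F y) p.1 (U.filter fun v => p.2 v = j)).2.2 < e + 1 + q) ⊆
          Ys.biUnion fun y => Finset.univ.filter fun p : (B → Bool) × (B → Fin q) =>
            e + 1 + q ≤ (encodeDNF (F y) p.1 (U.filter fun v => p.2 v = j)).2.2 := by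
        intro p hp
        simp only [Finset.mem_filter, Finset.mem_univ, true_and, Finset.mem_biUnion] at hp ⊢
        push Not at hp
        exact hp
      refine (Nat.cast_le (α := ℝ).2 ((Finset.card_le_card this).trans Finset.card_biUnion_le)).trans ?_
      rw [Nat.cast_sum]
      refine (Finset.sum_le_sum fun y hy => card_switching (F y) U w hw (hF y hy)
        (e + 1 + q) q hq j).trans (le_of_eq ?_)
      rw [Finset.sum_const, nsmul_eq_mul]
      ring)
  refine ⟨R, hRU, hcard, ?_⟩
  have hsub : (Finset.univ.filter fun x => ¬∀ y ∈ Ys,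
        HasCert (fun x => decide (EvalDNF (F y) x)) R x (e + 1 + q)).card ≤
      (Finset.univ.filter fun x => ¬∀ y ∈ Ys, (encodeDNF (F y) x R).2.2 < e + 1 + q).card := by
    refine Finset.card_le_card fun x hx => ?_
    simp only [Finset.mem_filter, Finset.mem_univ, true_and] at hx ⊢
    refine fun h => hx fun y hy => ?_
    obtain ⟨C, hC, hcC, hcert⟩ := exists_cert_encodeDNF (F y) x R
    exact ⟨C, hC, hcC.trans (h y hy).le, fun x' hx' => by simp only [hcert x' hx']⟩
  have hreal : (2 ^ n * ((Finset.univ.filter fun x => ¬∀ y ∈ Ys,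
      (encodeDNF (F y) x R).2.2 < e + 1 + q).card : ℝ)) ≤ 2 ^ Fintype.card B := by
    refine (mul_le_mul_of_nonneg_left hbad (show (0 : ℝ) ≤ 2 ^ n by positivity)).trans ?_
    have e1 : (2 : ℝ) ^ n * Ys.card ≤ 2 ^ e := by exact_mod_cast he
    have e2 : (q : ℝ) ≤ 2 ^ q := by exact_mod_cast (Nat.lt_two_pow_self).le
    have e3 : (2 : ℝ) ^ n * Ys.card * q ≤ 2 ^ e * 2 ^ q :=
      mul_le_mul e1 e2 (by positivity) (by positivity)
    calc (2 : ℝ) ^ n * (q * (Ys.card * (2 / 2 ^ (e + 1 + q))) * 2 ^ Fintype.card B)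
        = (2 : ℝ) ^ n * Ys.card * q * (2 / 2 ^ (e + 1 + q) * 2 ^ Fintype.card B) := by ring
      _ ≤ 2 ^ e * 2 ^ q * (2 / 2 ^ (e + 1 + q) * 2 ^ Fintype.card B) :=
          mul_le_mul_of_nonneg_right e3 (by positivity)
      _ = 2 ^ Fintype.card B := by
          rw [pow_add, pow_add]
          field_simp
  exact (Nat.mul_le_mul_left _ hsub).trans (by exact_mod_cast hreal)

/-- The union bound for `exists_restriction_dnf`, with `k = a * b`: the factors are `2 ^ e` for the
indices and the target probability, the number `2 * w` of colours, and the tail of the light mass.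
-/
theorem two_pow_mul_exp_le (e k : ℕ) :
    (2 : ℝ) ^ e * (2 * k * (2 * (e + k + 20)) : ℕ) *
      Real.exp (1 - (2 * (e + k + 20) : ℕ)) ≤ 1 := by
  obtain ⟨c, hc⟩ : ∃ c, c = e + k + 20 := ⟨_, rfl⟩
  rw [← hc]
  have h1 : (2 : ℝ) ^ (2 * c) ≤ Real.exp (2 * c : ℕ) := by
    have : (2 : ℝ) ≤ Real.exp 1 := by
      have := Real.add_one_le_exp (1 : ℝ)
      linarith
    refine (pow_le_pow_left₀ zero_le_two this _).trans (le_of_eq ?_)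
    rw [← Real.exp_nat_mul, mul_one]
  have h2 : Real.exp 1 ≤ 3 := by
    have := Real.exp_one_lt_d9
    linarith
  have h3 : 2 ^ e * (2 * k * (2 * c)) * 3 ≤ 2 ^ (2 * c) := by
    have u1 : c ≤ 2 ^ c := Nat.lt_two_pow_self.le
    have u2 : k ≤ 2 ^ k := Nat.lt_two_pow_self.le
    have u3 : 2 ^ c = 2 ^ e * 2 ^ k * 2 ^ 20 := by rw [hc, pow_add, pow_add]
    calc 2 ^ e * (2 * k * (2 * c)) * 3 = (2 ^ e * k * 12) * c := by ring
      _ ≤ (2 ^ e * 2 ^ k * 2 ^ 20) * 2 ^ c :=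
        Nat.mul_le_mul (Nat.mul_le_mul (Nat.mul_le_mul_left _ u2) (by norm_num)) u1
      _ = 2 ^ (2 * c) := by rw [← u3, two_mul, pow_add]
  have h3' : (2 : ℝ) ^ e * (2 * k * (2 * c) : ℕ) * 3 ≤ 2 ^ (2 * c) := by exact_mod_cast h3
  rw [Real.exp_sub, ← mul_div_assoc, div_le_one (Real.exp_pos _)]
  refine le_trans (mul_le_mul_of_nonneg_left h2 (by positivity)) (h3'.trans h1)

open Classical in
/-- Suppose that, for points `x` with `Yes y x`, a small change of `x` in the sense of a weight cannot
lead to `No y`. Then on a random restriction `Yes y` and `No y` are separated by a formula of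
small width. -/
theorem exists_restriction_dnf {Y : Type*} (Ys : Finset Y) (R : Finset B) (G : Finset (B → Bool))
    (Yes No : Y → (B → Bool) → Prop) (ν : Y → (B → Bool) → B → ℝ) (a b : ℕ) (ha : 0 < a)
    (hb : 0 < b)
    (hν : ∀ y ∈ Ys, ∀ x ∈ G, Yes y x → (∀ v, 0 ≤ ν y x v) ∧ ∑ v ∈ R, ν y x v ≤ a ∧
      ∀ x' : B → Bool, (∀ v, v ∉ R → x' v = x v) →
        ∑ v ∈ R with x' v ≠ x v, ν y x v < 1 / b → ¬No y x')
    (n e : ℕ) (he : 2 ^ n * Ys.card ≤ 2 ^ e) (w : ℕ) (hw : w = a * b * (2 * (e + a * b + 20))) :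
    ∃ R' ⊆ R, R.card ≤ 2 * w * R'.card ∧ ∃ G' ⊆ G, 2 ^ n * (G \ G').card ≤ 2 ^ Fintype.card B ∧
      ∃ F : Y → List (Term B), (∀ y ∈ Ys, ∀ t ∈ F y, (t.2 ∩ R').card ≤ w) ∧
        (∀ y ∈ Ys, ∀ x ∈ G', Yes y x → EvalDNF (F y) x) ∧
        ∀ y ∈ Ys, ∀ x, No y x → ¬EvalDNF (F y) x := by
  set κ := 2 * (e + a * b + 20) with hκ
  have hκ0 : (0 : ℝ) < κ := by
    rw [hκ]
    positivity
  have hb' : (0 : ℝ) < b := by exact_mod_cast hb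
  have ha' : (0 : ℝ) < a := by exact_mod_cast ha
  -- The threshold between light and heavy balances two needs: at most `a / τ = w` coordinates are
  -- heavy, and the tail exponent `(1 / b) / τ` for the light mass is `κ`.
  set τ : ℝ := 1 / (b * κ) with hτ
  have hτ0 : 0 < τ := by positivity
  have hw0 : 0 < w := by
    rw [hw, hκ]
    positivity
  have hwr : (w : ℝ) = a * b * κ := by rw [hw]; push_cast; ring
  have hwτ : (w : ℝ) * τ = a := by
    rw [hwr, hτ]
    field_simp
  set bad : Finset B → (B → Bool) → Y → Prop := fun R' x y =>
    x ∈ G ∧ Yes y x ∧ 1 / (b : ℝ) ≤ ∑ v ∈ R' with ν y x v ≤ τ, ν y x v with hbad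
  obtain ⟨R', hR', hcard, hBad⟩ := exists_large_restriction R (2 * w) (by omega)
    (Ys.card * Real.exp (1 - κ)) (fun R' x => ∃ y ∈ Ys, bad R' x y) (by
      intro j
      have hx : ∀ x : B → Bool, ((Finset.univ.filter fun χ : B → Fin (2 * w) => ∃ y ∈ Ys,
          bad (R.filter fun v => χ v = j) x y).card : ℝ) ≤
            Ys.card * (((2 * w : ℕ) : ℝ) ^ Fintype.card B * Real.exp (1 - κ)) := by
        intro x
        have : (Finset.univ.filter fun χ : B → Fin (2 * w) => ∃ y ∈ Ys,
            bad (R.filter fun v => χ v = j) x y) ⊆ Ys.biUnion fun y =>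
            Finset.univ.filter fun χ : B → Fin (2 * w) =>
              bad (R.filter fun v => χ v = j) x y := by
          intro χ hχ
          simpa using hχ
        refine (Nat.cast_le (α := ℝ).2 ((Finset.card_le_card this).trans Finset.card_biUnion_le)).trans ?_
        rw [Nat.cast_sum, ← nsmul_eq_mul, ← Finset.sum_const]
        refine Finset.sum_le_sum fun y hy => ?_
        by_cases hG : x ∈ G ∧ Yes y x
        · have hν' := hν y hy x hG.1 hG.2
          have := card_coloring_weight_ge (R.filter fun v => ν y x v ≤ τ) (ν y x) τ (1 / b) a
            (2 * w) (by omega) hτ0 (fun v hv => ⟨hν'.1 v, (Finset.mem_filter.1 hv).2⟩)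
            ((Finset.sum_le_sum_of_subset_of_nonneg (Finset.filter_subset _ _)
              fun v _ _ => hν'.1 v).trans hν'.2.1)
            (by push_cast; rw [mul_assoc, hwτ]) j
          have hdiv : (1 : ℝ) / b / τ = κ := by
            rw [hτ]
            field_simp
          rw [hdiv] at this
          refine le_trans (Nat.cast_le (α := ℝ).2 (Finset.card_le_card fun χ hχ => ?_)) this
          simp only [Finset.mem_filter, Finset.mem_univ, true_and, hbad] at hχ ⊢
          rw [Finset.filter_comm]
          exact hχ.2.2
        · rw [Finset.filter_false_of_mem (fun χ _ h => hG ⟨h.1, h.2.1⟩)]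
          simp only [Finset.card_empty, Nat.cast_zero]
          positivity
      have hsplit : (Finset.univ.filter fun p : (B → Bool) × (B → Fin (2 * w)) => ∃ y ∈ Ys,
          bad (R.filter fun v => p.2 v = j) p.1 y).card = ∑ x : B → Bool,
            (Finset.univ.filter fun χ : B → Fin (2 * w) => ∃ y ∈ Ys,
              bad (R.filter fun v => χ v = j) x y).card := by
        rw [Finset.card_filter, Fintype.sum_prod_type]
        exact Finset.sum_congr rfl fun x _ => (Finset.card_filter _ _).symm
      rw [hsplit, Nat.cast_sum]
      refine (Finset.sum_le_sum fun x _ => hx x).trans (le_of_eq ?_)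
      rw [Finset.sum_const, Finset.card_univ, Fintype.card_fun, Fintype.card_bool, nsmul_eq_mul]
      push_cast
      ring)
  -- One term for each good accepting point `z`: agree with `z` everywhere off `R'` and at the heavy
  -- coordinates of `z` in `R'`. Only the latter count for the width in `R'`.
  refine ⟨R', hR', hcard, G.filter fun x => ¬∃ y ∈ Ys, bad R' x y, Finset.filter_subset _ _, ?_,
    fun y => (G.filter fun x => Yes y x ∧ ¬bad R' x y).toList.map fun z =>
      (z, R'ᶜ ∪ R'.filter fun v => τ < ν y z v), ?_, ?_, ?_⟩
  · have hsub : (G \ G.filter fun x => ¬∃ y ∈ Ys, bad R' x y).card ≤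
        (Finset.univ.filter fun x => ∃ y ∈ Ys, bad R' x y).card := by
      refine Finset.card_le_card fun x hx => ?_
      simp only [Finset.mem_sdiff, Finset.mem_filter, Finset.mem_univ, true_and, not_and,
        not_not] at hx ⊢
      exact hx.2 hx.1
    have hreal : (2 : ℝ) ^ n * ((Finset.univ.filter fun x => ∃ y ∈ Ys, bad R' x y).card : ℝ) ≤
        2 ^ Fintype.card B := by
      refine (mul_le_mul_of_nonneg_left hBad (show (0 : ℝ) ≤ 2 ^ n by positivity)).trans ?_
      have e1 : (2 : ℝ) ^ n * Ys.card ≤ 2 ^ e := by exact_mod_cast he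
      have e2 := two_pow_mul_exp_le e (a * b)
      rw [← hκ] at e2
      have e3 : 2 * w = 2 * (a * b) * κ := by rw [hw]; ring
      calc (2 : ℝ) ^ n * ((2 * w : ℕ) * (Ys.card * Real.exp (1 - κ)) * 2 ^ Fintype.card B)
          = (2 : ℝ) ^ n * Ys.card * ((2 * w : ℕ) * Real.exp (1 - κ) * 2 ^ Fintype.card B) := by ring
        _ ≤ 2 ^ e * ((2 * w : ℕ) * Real.exp (1 - κ) * 2 ^ Fintype.card B) :=
            mul_le_mul_of_nonneg_right e1 (by positivity)
        _ = 2 ^ e * (2 * (a * b) * κ : ℕ) * Real.exp (1 - κ) * 2 ^ Fintype.card B := by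
            rw [e3]
            ring
        _ ≤ 1 * 2 ^ Fintype.card B := mul_le_mul_of_nonneg_right e2 (by positivity)
        _ = _ := one_mul _
    exact (Nat.mul_le_mul_left _ hsub).trans (by exact_mod_cast hreal)
  · intro y hy t ht
    obtain ⟨z, hz, rfl⟩ := List.mem_map.1 ht
    rw [Finset.mem_toList, Finset.mem_filter] at hz
    have hν' := hν y hy z hz.1 hz.2.1
    have e1 : (R'ᶜ ∪ R'.filter fun v => τ < ν y z v) ∩ R' = R'.filter fun v => τ < ν y z v := by
      ext v
      simp only [Finset.mem_inter, Finset.mem_union, Finset.mem_compl, Finset.mem_filter]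
      tauto
    simp only [e1]
    have e2 : ((R'.filter fun v => τ < ν y z v).card : ℝ) * τ ≤ w * τ := by
      rw [hwτ, ← nsmul_eq_mul]
      refine (Finset.card_nsmul_le_sum _ (ν y z) τ fun v hv => (Finset.mem_filter.1 hv).2.le).trans ?_
      exact (Finset.sum_le_sum_of_subset_of_nonneg ((Finset.filter_subset _ _).trans hR')
        fun v _ _ => hν'.1 v).trans hν'.2.1
    exact_mod_cast le_of_mul_le_mul_right e2 hτ0
  · intro y hy x hx hyes
    rw [Finset.mem_filter] at hx
    refine ⟨_, List.mem_map.2 ⟨x, ?_, rfl⟩, fun v _ => rfl⟩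
    rw [Finset.mem_toList, Finset.mem_filter]
    exact ⟨hx.1, hyes, fun h => hx.2 ⟨y, hy, h⟩⟩
  -- A point satisfying the term of `z` differs from `z` only at light coordinates of `R'`. Their
  -- total mass is below `1 / b`, because `z` is not bad.
  · rintro y hy x hno ⟨t, ht, hsat⟩
    obtain ⟨z, hz, rfl⟩ := List.mem_map.1 ht
    rw [Finset.mem_toList, Finset.mem_filter] at hz
    have hν' := hν y hy z hz.1 hz.2.1
    simp only [Finset.mem_union, Finset.mem_compl, Finset.mem_filter] at hsat
    refine hν'.2.2 x (fun v hv => hsat v (Or.inl fun h => hv (hR' h))) ?_ hno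
    have hlt : ∑ v ∈ R' with ν y z v ≤ τ, ν y z v < 1 / b := by
      by_contra h
      exact hz.2.2 ⟨hz.1, hz.2.1, not_lt.1 h⟩
    refine lt_of_le_of_lt (Finset.sum_le_sum_of_subset_of_nonneg ?_ fun v _ _ => hν'.1 v) hlt
    intro v hv
    rw [Finset.mem_filter] at hv ⊢
    have h1 : v ∈ R' := by
      by_contra h
      exact hv.2 (hsat v (Or.inl h))
    exact ⟨h1, not_lt.1 fun h => hv.2 (hsat v (Or.inr ⟨h1, h⟩))⟩

/-- One level of the hierarchy: on a large restriction, `Yes y` and `No y` are separated, at most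
points, by functions with small certificates. -/
theorem exists_separating {Y : Type*} (Ys : Finset Y) (R : Finset B) (G : Finset (B → Bool))
    (Yes No : Y → (B → Bool) → Prop) (ν : Y → (B → Bool) → B → ℝ) (a b : ℕ) (ha : 0 < a)
    (hb : 0 < b)
    (hν : ∀ y ∈ Ys, ∀ x ∈ G, Yes y x → (∀ v, 0 ≤ ν y x v) ∧ ∑ v ∈ R, ν y x v ≤ a ∧
      ∀ x' : B → Bool, (∀ v, v ∉ R → x' v = x v) →
        ∑ v ∈ R with x' v ≠ x v, ν y x v < 1 / b → ¬No y x')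
    (n e : ℕ) (he : 2 ^ n * Ys.card ≤ 2 ^ e) (w : ℕ) (hw : w = a * b * (2 * (e + a * b + 20))) :
    ∃ R' : Finset B, R.card ≤ 2 * w * (16 * w + 1) * R'.card ∧
      ∃ G' ⊆ G, 2 ^ n * (G \ G').card ≤ 2 * 2 ^ Fintype.card B ∧
      ∃ g : Y → (B → Bool) → Bool, ∀ y ∈ Ys, ∀ x ∈ G',
        HasCert (g y) R' x (e + 1 + (16 * w + 1)) ∧ (Yes y x → g y x = true) ∧
          (No y x → g y x = false) := by
  classical
  have hw0 : 0 < w := by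
    rw [hw]
    positivity
  obtain ⟨R1, -, hcard1, G1, hG1, hbad1, F, hF, hyes, hno⟩ :=
    exists_restriction_dnf Ys R G Yes No ν a b ha hb hν n e he w hw
  obtain ⟨R2, -, hcard2, hbad2⟩ := exists_restriction_hasCert Ys R1 F w hw0 hF n e he
  refine ⟨R2, ?_, G1.filter fun x => ∀ y ∈ Ys,
    HasCert (fun x => decide (EvalDNF (F y) x)) R2 x (e + 1 + (16 * w + 1)),
    (Finset.filter_subset _ _).trans hG1, ?_, fun y x => decide (EvalDNF (F y) x), ?_⟩
  · rw [mul_assoc]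
    exact hcard1.trans (Nat.mul_le_mul_left _ hcard2)
  · refine (Nat.mul_le_mul_left _ ((Finset.card_le_card (t := (G \ G1) ∪ Finset.univ.filter fun x =>
      ¬∀ y ∈ Ys, HasCert (fun x => decide (EvalDNF (F y) x)) R2 x (e + 1 + (16 * w + 1))) ?_).trans
      (Finset.card_union_le _ _))).trans ?_
    · intro x hx
      simp only [Finset.mem_sdiff, Finset.mem_filter, Finset.mem_univ, true_and,
        Finset.mem_union] at hx ⊢
      tauto
    · rw [mul_add, two_mul]
      exact add_le_add hbad1 hbad2
  · intro y hy x hx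
    rw [Finset.mem_filter] at hx
    refine ⟨hx.2 y hy, fun h => ?_, fun h => ?_⟩
    · simpa using hyes y hy x hx.1 h
    · simpa using hno y hy x h

end Collapse

/-! ## Oracle machines make few and short queries -/

theorem Machine.step_eq_none_iff (M : Machine) (O : BitLanguage) (c : Config) :
    M.step O c = none ↔ M[c.pos]? = none := by
  unfold Machine.step
  split
  · simp [*]
  · simp [*]
  · split <;> simp [*]
  · simp [*]

theorem Machine.length_stack_step_le (M : Machine) (O : BitLanguage) (c c' : Config)
    (h : M.step O c = some c') (s : ℕ) : (c'.stack s).length ≤ (c.stack s).length + 1 := by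
  unfold Machine.step at h
  have upd : ∀ (i : ℕ) (l : List Bool), l.length ≤ (c.stack i).length + 1 →
      (Function.update c.stack i l s).length ≤ (c.stack s).length + 1 := by
    intro i l hl
    by_cases hs : s = i
    · subst hs
      simpa using hl
    · rw [Function.update_of_ne hs]
      omega
  split at h
  · simp at h
  · simp only [Option.some.injEq] at h
    subst h
    exact upd _ _ (by simp)
  · split at h <;> (simp only [Option.some.injEq] at h; subst h)
    · simp
    · exact upd _ _ (by simp [*]; omega)
    · exact upd _ _ (by simp [*]; omega)
  · simp only [Option.some.injEq] at h
    subst h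
    simp

theorem Machine.length_stack_run_le (M : Machine) (O : BitLanguage) (t : ℕ) (c : Config) (s : ℕ) :
    ((M.run O t c).stack s).length ≤ (c.stack s).length + t := by
  induction t generalizing c with
  | zero => simp [Machine.run]
  | succ t ih =>
    rw [Machine.run]
    split
    · omega
    · next c' h =>
      have := M.length_stack_step_le O c c' h s
      have := ih c'
      omega

theorem Machine.step_congr (M : Machine) (O O' : BitLanguage) (c : Config)
    (h : O' (c.stack 2) = O (c.stack 2)) : M.step O' c = M.step O c := by
  unfold Machine.step
  rw [h]

/-- The strings on the query tape along the run with `O` determine the run. They are recorded at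
every step, even when no query is made, which does not affect the bound. -/
theorem Machine.exists_queries (M : Machine) (O : BitLanguage) (t : ℕ) (c : Config) :
    ∃ C : Finset (List Bool), C.card ≤ t ∧ (∀ u ∈ C, u.length ≤ (c.stack 2).length + t) ∧
      ∀ O' : BitLanguage, (∀ u ∈ C, O' u = O u) → M.run O' t c = M.run O t c := by
  induction t generalizing c with
  | zero => exact ⟨∅, by simp, by simp, fun _ _ => rfl⟩
  | succ t ih =>
    cases h : M.step O c with
    | none =>
      refine ⟨∅, by simp, by simp, fun O' _ => ?_⟩
      have h' : M.step O' c = none := by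
        rw [Machine.step_eq_none_iff] at h ⊢
        exact h
      simp [Machine.run, h, h']
    | some c' =>
      obtain ⟨C, hC, hlen, hrun⟩ := ih c'
      have hl := M.length_stack_step_le O c c' h 2
      refine ⟨insert (c.stack 2) C, (Finset.card_insert_le _ _).trans (by omega), ?_, ?_⟩
      · intro u hu
        rcases Finset.mem_insert.1 hu with rfl | hu
        · omega
        · have := hlen u hu
          omega
      · intro O' hO'
        have h' : M.step O' c = some c' := by
          rw [M.step_congr O O' c (hO' _ (Finset.mem_insert_self _ _)), h]
        simp only [Machine.run, h, h']
        exact hrun O' fun u hu => hO' u (Finset.mem_insert_of_mem hu)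

theorem Machine.exists_queries_outputsWithin (M : Machine) (O : BitLanguage) (x r : List Bool)
    (t : ℕ) : ∃ C : Finset (List Bool), C.card ≤ t ∧ (∀ u ∈ C, u.length ≤ t) ∧
      ∀ O' : BitLanguage, (∀ u ∈ C, O' u = O u) → ∀ y,
        (M.OutputsWithin O' x r t y ↔ M.OutputsWithin O x r t y) := by
  obtain ⟨C, hC, hlen, hrun⟩ := M.exists_queries O t (initConfig x r)
  refine ⟨C, hC, fun u hu => by simpa [initConfig] using hlen u hu, fun O' hO' y => ?_⟩
  unfold Machine.OutputsWithin
  rw [hrun O' hO', Machine.step_eq_none_iff, Machine.step_eq_none_iff]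

theorem Machine.OutputsWithin.unique {M : Machine} {O : BitLanguage} {x r : List Bool} {t : ℕ}
    {y y' : List Bool} (h : M.OutputsWithin O x r t y) (h' : M.OutputsWithin O x r t y') :
    y = y' :=
  h.2.symm.trans h'.2

theorem Machine.OutputsWithin.length_le {M : Machine} {O : BitLanguage} {x r : List Bool} {t : ℕ}
    {y : List Bool} (h : M.OutputsWithin O x r t y) : y.length ≤ t := by
  have := M.length_stack_run_le O t (initConfig x r) 3
  rw [h.2] at this
  simpa [initConfig] using this

/-! ## The encoding of circuits -/

theorem length_le_encodeList {α : Type} (f : α → List Bool) (l : List α) :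
    l.length ≤ (encodeList f l).length := by
  induction l with
  | nil => simp
  | cons a l ih =>
    simp only [encodeList, List.length_cons, List.length_append]
    omega

theorem length_le_encodeList_of_mem {α : Type} (f : α → List Bool) (l : List α) (a : α)
    (ha : a ∈ l) : (f a).length ≤ (encodeList f l).length := by
  induction l with
  | nil => simp at ha
  | cons b l ih =>
    simp only [encodeList, List.length_cons, List.length_append]
    rcases List.mem_cons.1 ha with rfl | ha
    · omega
    · have := ih ha
      omega

theorem Gate.arity_le_length_encode {n : ℕ} (g : Gate n) : g.arity ≤ g.encode.length := by
  cases g with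
  | oracle wires t h =>
    have := length_le_encodeList (fun i : Fin n => encodeNat i) wires
    simp only [Gate.arity, Gate.encode, List.length_cons, List.length_append]
    omega
  | _ => simp [Gate.arity]

theorem Circuit.length_gates_le (C : Circuit) : C.gates.length ≤ C.encode.length := by
  have := length_le_encodeList Gate.encode C.gates
  simp only [Circuit.encode, List.length_append]
  omega

theorem Circuit.arity_le (C : Circuit) (g : Gate (C.witness + C.ancilla)) (hg : g ∈ C.gates) :
    g.arity ≤ C.encode.length := by
  have h1 := g.arity_le_length_encode
  have h2 := length_le_encodeList_of_mem Gate.encode C.gates g hg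
  simp only [Circuit.encode, List.length_append]
  omega

theorem Circuit.length_encode_pos (C : Circuit) : 0 < C.encode.length := by
  simp [Circuit.encode, encodeNat]

/-- An encoding such that no code word is a proper prefix of another one. -/
def PrefixInjective {α : Type} (f : α → List Bool) : Prop :=
  ∀ a b u v, f a ++ u = f b ++ v → a = b ∧ u = v

theorem prefixInjective_encodeNat : PrefixInjective encodeNat := by
  intro a
  induction a with
  | zero =>
    rintro (_ | b) u v h
    · simpa [encodeNat] using h
    · simp [encodeNat, List.replicate_succ] at h
  | succ a ih =>
    rintro (_ | b) u v h
    · simp [encodeNat, List.replicate_succ] at h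
    · have := ih b u v (by simpa [encodeNat, List.replicate_succ] using h)
      exact ⟨congrArg _ this.1, this.2⟩

theorem prefixInjective_encodeFin (n : ℕ) : PrefixInjective fun i : Fin n => encodeNat i := by
  intro a b u v h
  have := prefixInjective_encodeNat _ _ _ _ h
  exact ⟨Fin.ext this.1, this.2⟩

theorem PrefixInjective.encodeList {α : Type} {f : α → List Bool} (hf : PrefixInjective f) :
    PrefixInjective (encodeList f) := by
  intro a
  induction a with
  | nil =>
    rintro (_ | ⟨b, l⟩) u v h
    · simpa [QMAHierarchy.encodeList] using h
    · simp [QMAHierarchy.encodeList] at h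
  | cons a l ih =>
    rintro (_ | ⟨b, l'⟩) u v h
    · simp [QMAHierarchy.encodeList] at h
    · simp only [QMAHierarchy.encodeList, List.cons_append, List.cons.injEq, true_and,
        List.append_assoc] at h
      obtain ⟨rfl, h1⟩ := hf _ _ _ _ h
      obtain ⟨rfl, h2⟩ := ih _ _ _ h1
      exact ⟨rfl, h2⟩

theorem prefixInjective_gateEncode (n : ℕ) : PrefixInjective (Gate.encode (n := n)) := by
  intro a b u v h
  have hn := prefixInjective_encodeFin n
  cases a <;> cases b <;>
    simp only [Gate.encode, List.cons_append, List.cons.injEq, true_and, List.append_assoc,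
      reduceCtorEq, false_and, and_false] at h
  · obtain ⟨rfl, h1⟩ := hn _ _ _ _ h
    exact ⟨rfl, h1⟩
  · obtain ⟨rfl, h1⟩ := hn _ _ _ _ h
    exact ⟨rfl, h1⟩
  · obtain ⟨rfl, h1⟩ := hn _ _ _ _ h
    obtain ⟨rfl, h2⟩ := hn _ _ _ _ h1
    obtain ⟨rfl, h3⟩ := hn _ _ _ _ h2
    exact ⟨rfl, h3⟩
  · obtain ⟨rfl, h1⟩ := hn.encodeList _ _ _ _ h
    obtain ⟨rfl, h2⟩ := hn _ _ _ _ h1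
    exact ⟨rfl, h2⟩

theorem Circuit.encode_injective : Function.Injective Circuit.encode := by
  rintro ⟨w, a, o, g⟩ ⟨w', a', o', g'⟩ h
  simp only [Circuit.encode] at h
  obtain ⟨rfl, h1⟩ := prefixInjective_encodeNat _ _ _ _ h
  obtain ⟨rfl, h2⟩ := prefixInjective_encodeNat _ _ _ _ h1
  obtain ⟨rfl, h3⟩ := prefixInjective_encodeFin _ _ _ _ _ h2
  obtain ⟨rfl, -⟩ := (prefixInjective_gateEncode _).encodeList _ _ [] []
    (by simpa only [List.append_nil] using h3)
  rfl

/-! ## There are countably many machines and verifiers -/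

instance : Countable Instr := by
  let f : Instr → (ℕ × Bool × ℕ) ⊕ (ℕ × ℕ × ℕ × ℕ) ⊕ (ℕ × ℕ) := fun i =>
    match i with
    | .push s b n => .inl (s, b, n)
    | .pop s a b c => .inr (.inl (s, a, b, c))
    | .query a b => .inr (.inr (a, b))
  refine Function.Injective.countable (f := f) ?_
  intro i j h
  cases i <;> cases j <;> simp_all [f]

instance : Countable (Polynomial ℕ) :=
  Function.Injective.countable (f := fun p : Polynomial ℕ => p.toFinsupp.coeff)
    fun _ _ h => by
      apply Polynomial.toFinsupp_injective
      exact AddMonoidAlgebra.coeff_injective h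

/-- The generator runs without oracle and its output is an injective code of the circuit, so a
program and a time bound determine the verifier. -/
instance : Countable QMAVerifier := by
  refine Function.Injective.countable (f := fun V : QMAVerifier =>
    ((V.generator : List Instr), V.time)) ?_
  rintro ⟨C, M, p, h⟩ ⟨C', M', p', h'⟩ e
  simp only [Prod.mk.injEq] at e
  obtain ⟨rfl, rfl⟩ := e
  have : C = C' := funext fun x => Circuit.encode_injective ((h x).unique (h' x))
  subst this
  rfl

/-! ## The promise problem decided by a chain of verifiers -/

/-- With oracle `O`, the machine `M` with time bound `p`, followed by the verifiers `Vs` (the last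
entry queries `M`), decides that the answer on `y` is `b`. -/
def Decided (M : Machine) (p : Polynomial ℕ) (O : BitLanguage) :
    List QMAVerifier → List Bool → Bool → Prop
  | [], y, b => M.OutputsWithin O y [] (p.eval y.length) [b]
  | V :: Vs, y, b => ∀ A : BitLanguage, (∀ z c, Decided M p O Vs z c → A z = c) →
      (b = true → ∃ φ : QState (V.circuit y).witness, ‖φ‖ = 1 ∧
        2 / 3 ≤ (V.circuit y).acceptProb (join O A) φ) ∧
      (b = false → ∀ φ : QState (V.circuit y).witness, ‖φ‖ = 1 →
        (V.circuit y).acceptProb (join O A) φ ≤ 1 / 3)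

/-- The constants `2 / 3` and `1 / 3` exclude both answers at once, provided there is some language
answering the queries; that language comes from the level below. Without it the quantifier over `A`
in `Decided` would be vacuous. -/
theorem exists_forall_decided (M : Machine) (p : Polynomial ℕ) (O : BitLanguage)
    (Vs : List QMAVerifier) :
    ∃ A : BitLanguage, ∀ y b, Decided M p O Vs y b → A y = b := by
  classical
  suffices h : ∀ y, Decided M p O Vs y true → ¬Decided M p O Vs y false by
    refine ⟨fun y => decide (Decided M p O Vs y true), fun y b hb => ?_⟩
    cases b
    · exact decide_eq_false fun h' => h y h' hb
    · exact decide_eq_true hb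
  induction Vs with
  | nil =>
    intro y h h'
    simpa using Machine.OutputsWithin.unique h h'
  | cons V Vs ih =>
    intro y h h'
    let A : BitLanguage := fun y => decide (Decided M p O Vs y true)
    have hA : ∀ y b, Decided M p O Vs y b → A y = b := by
      intro y b hb
      cases b
      · exact decide_eq_false fun h' => ih y h' hb
      · exact decide_eq_true hb
    obtain ⟨φ, hφ, h1⟩ := (h A hA).1 rfl
    have h2 := (h' A hA).2 rfl φ hφ
    linarith

/-- Each promise problem on the way down is replaced by the largest one that the remaining chain
decides. A language extending the larger problem extends the smaller one, so the verifiers still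
work, and what is left is countable data independent of the problems. -/
theorem exists_decided_of_mem_level (O : BitLanguage) (k : ℕ) (Q : PromiseProblem)
    (hQ : Q ∈ PromiseQMAHLevel O k) :
    ∃ (M : Machine) (p : Polynomial ℕ) (Vs : List QMAVerifier),
      ∀ x b, Q x = some b → Decided M p O Vs x b := by
  induction k generalizing Q with
  | zero =>
    obtain ⟨M, p, h⟩ := hQ
    exact ⟨M, p, [], h⟩
  | succ k ih =>
    simp only [PromiseQMAHLevel, Set.mem_iUnion] at hQ
    obtain ⟨R, hR, V, hV⟩ := hQ
    obtain ⟨M, p, Vs, h⟩ := ih R hR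
    refine ⟨M, p, V :: Vs, fun x b hx A hA => ?_⟩
    have := hV A (fun z c hz => hA z c (h z c hz)) x
    exact ⟨fun hb => this.1 (hb ▸ hx), fun hb => this.2 (hb ▸ hx)⟩

/-! ## Short strings and the cube of oracles -/

/-- The strings of length at most `k`. -/
def shortStrings (k : ℕ) : Finset (List Bool) :=
  (Finset.range (k + 1)).biUnion fun i =>
    (Finset.univ : Finset (List.Vector Bool i)).image List.Vector.toList

theorem mem_shortStrings {k : ℕ} {u : List Bool} : u ∈ shortStrings k ↔ u.length ≤ k := by
  simp only [shortStrings, Finset.mem_biUnion, Finset.mem_range, Finset.mem_image, Finset.mem_univ,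
    true_and]
  constructor
  · rintro ⟨i, hi, v, rfl⟩
    rw [v.toList_length]
    omega
  · exact fun h => ⟨u.length, by omega, ⟨u, rfl⟩, rfl⟩

theorem card_shortStrings_le (k : ℕ) : (shortStrings k).card ≤ 2 ^ (k + 1) := by
  refine Finset.card_biUnion_le.trans ?_
  have : ∀ i ∈ Finset.range (k + 1),
      ((Finset.univ : Finset (List.Vector Bool i)).image List.Vector.toList).card ≤ 2 ^ i := by
    intro i _
    refine Finset.card_image_le.trans (le_of_eq ?_)
    rw [Finset.card_univ, card_vector, Fintype.card_bool]
  refine (Finset.sum_le_sum this).trans ?_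
  have := Nat.geomSum_lt (s := Finset.range (k + 1)) (n := k + 1) (m := 2) le_rfl (by simp)
  exact this.le

/-- The oracle `O`, with the answers on the strings of length `n` replaced by `x`. -/
def cubeOracle (n : ℕ) (O : BitLanguage) (x : List.Vector Bool n → Bool) : BitLanguage :=
  fun u => if h : u.length = n then x ⟨u, h⟩ else O u

theorem cubeOracle_congr {n : ℕ} {O : BitLanguage} {x x' : List.Vector Bool n → Bool}
    {u : List Bool} (h : ∀ v : List.Vector Bool n, v.val = u → x' v = x v) :
    cubeOracle n O x' u = cubeOracle n O x u := by
  unfold cubeOracle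
  split_ifs with hu
  · exact h ⟨u, hu⟩ rfl
  · rfl

theorem eval_mono_nat (p : Polynomial ℕ) {a b : ℕ} (h : a ≤ b) : p.eval a ≤ p.eval b := by
  rw [Polynomial.eval_eq_sum_range, Polynomial.eval_eq_sum_range]
  exact Finset.sum_le_sum fun i _ => Nat.mul_le_mul_left _ (Nat.pow_le_pow_left h i)

/-! ## Functions with small certificates for every level of the hierarchy -/

/-- The weights with which an accepting verifier depends on the coordinates of its oracle, when the
answers to its queries have small certificates. -/
theorem Circuit.exists_coordinateWeight (C : Circuit) (T : ℕ) (hT : C.encode.length ≤ T) (n : ℕ)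
    (O : BitLanguage) (g : List Bool → (List.Vector Bool n → Bool) → Bool)
    (R : Finset (List.Vector Bool n)) (x : List.Vector Bool n → Bool) (s : ℕ)
    (hg : ∀ u : List Bool, u.length ≤ T → HasCert (g u) R x s) (φ : QState C.witness)
    (hφ : ‖φ‖ = 1) (hacc : 2 / 3 ≤ C.acceptProb (join (cubeOracle n O x) fun u => g u x) φ) :
    ∃ ν : List.Vector Bool n → ℝ, (∀ v, 0 ≤ ν v) ∧ ∑ v ∈ R, ν v ≤ ((s + 1) * T : ℕ) ∧
      ∀ x' : List.Vector Bool n → Bool, (∀ v, v ∉ R → x' v = x v) →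
        ∑ v ∈ R with x' v ≠ x v, ν v < 1 / (144 * T : ℕ) →
          ¬∀ φ : QState C.witness, ‖φ‖ = 1 →
            C.acceptProb (join (cubeOracle n O x') fun u => g u x') φ ≤ 1 / 3 := by
  have hT0 : 0 < T := C.length_encode_pos.trans_le hT
  obtain ⟨w, hw0, hwT, hw⟩ := C.exists_queryWeight T hT0 (C.length_gates_le.trans hT)
    (shortStrings T) (fun g hg q hq => mem_shortStrings.2 (hq.trans ((C.arity_le g hg).trans hT)))
    _ φ hφ hacc
  -- A query to the cube oracle reads at most one coordinate and a query to the lower level has a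
  -- certificate of size `s`; `s + 1` bounds both.
  have hcert : ∀ q : List Bool, ∃ K ⊆ R, K.card ≤ s + 1 ∧ (q.length ≤ T →
      ∀ x' : List.Vector Bool n → Bool, (∀ v, v ∉ R ∨ v ∈ K → x' v = x v) →
        join (cubeOracle n O x') (fun u => g u x') q =
          join (cubeOracle n O x) (fun u => g u x) q) := by
    rintro (_ | ⟨_ | _, u⟩)
    · exact ⟨∅, by simp, by simp, fun _ _ _ => rfl⟩
    · refine ⟨R.filter fun v => v.val = u, Finset.filter_subset _ _, ?_, fun _ x' hx' => ?_⟩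
      · refine (Finset.card_le_one.2 fun a ha b hb => ?_).trans (by omega)
        exact Subtype.ext ((Finset.mem_filter.1 ha).2.trans (Finset.mem_filter.1 hb).2.symm)
      · refine cubeOracle_congr fun v hv => hx' v ?_
        by_cases hvR : v ∈ R
        · exact Or.inr (Finset.mem_filter.2 ⟨hvR, hv⟩)
        · exact Or.inl hvR
    · by_cases hu : u.length ≤ T
      · obtain ⟨K, hK, hcard, h⟩ := hg u hu
        exact ⟨K, hK, by omega, fun _ x' hx' => h x' hx'⟩
      · exact ⟨∅, by simp, by simp, fun h => absurd h (by simp; omega)⟩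
  choose K hKR hKcard hK using hcert
  -- Every query charges its full weight to each coordinate of its certificate. An answer can change
  -- only if such a coordinate changes, so the weight of the altered queries is at most that of the
  -- altered coordinates.
  refine ⟨fun v => ∑ q ∈ shortStrings T, if v ∈ K q then w q else 0,
    fun v => Finset.sum_nonneg fun q _ => ?_, ?_, fun x' hx' hlt hno => ?_⟩
  · split_ifs
    · exact hw0 q
    · exact le_rfl
  · rw [Finset.sum_comm]
    have : ∀ q ∈ shortStrings T, (∑ v ∈ R, if v ∈ K q then w q else 0) ≤ ((s + 1 : ℕ) : ℝ) * w q := by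
      intro q _
      rw [← Finset.sum_filter, Finset.sum_const, nsmul_eq_mul]
      refine mul_le_mul_of_nonneg_right (Nat.cast_le.2 (le_trans ?_ (hKcard q))) (hw0 q)
      exact Finset.card_le_card fun v hv => (Finset.mem_filter.1 hv).2
    refine (Finset.sum_le_sum this).trans ?_
    rw [← Finset.mul_sum, Nat.cast_mul]
    exact mul_le_mul_of_nonneg_left hwT (Nat.cast_nonneg _)
  · have h1 := hw (join (cubeOracle n O x') fun u => g u x') (lt_of_le_of_lt ?_ (by
      push_cast at hlt
      exact hlt))
    · have := hno φ hφ
      linarith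
    · rw [Finset.sum_comm, Finset.sum_filter]
      refine Finset.sum_le_sum fun q hq => ?_
      have hnn : ∀ v, 0 ≤ if v ∈ K q then w q else 0 := by
        intro v
        split_ifs
        · exact hw0 q
        · exact le_rfl
      split_ifs with hne
      · obtain ⟨v, hv, hvne⟩ : ∃ v ∈ K q, x' v ≠ x v := by
          by_contra hcon
          push Not at hcon
          refine hne (hK q (mem_shortStrings.1 hq) x' fun v hv => ?_).symm
          exact hv.elim (hx' v) (hcon v)
        have := Finset.single_le_sum (f := fun v => if v ∈ K q then w q else 0)
          (s := R.filter fun v => x' v ≠ x v) (fun v _ => hnn v)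
          (Finset.mem_filter.2 ⟨hKR q hv, hvne⟩)
        simpa [hv] using this
      · exact Finset.sum_nonneg fun v _ => hnn v

/-- The bottom level needs no restriction: the queries of length `n` certify the answer of the
machine at every point. -/
theorem exists_certified_of_machine (M : Machine) (p ℓ : Polynomial ℕ) (n : ℕ) (O : BitLanguage) :
    ∃ g : List Bool → (List.Vector Bool n → Bool) → Bool, ∀ x y, y.length ≤ ℓ.eval n →
      HasCert (g y) Finset.univ x ((p.comp ℓ).eval n) ∧
        ∀ O' : BitLanguage, (∀ u, u.length ≤ (p.comp ℓ).eval n → O' u = cubeOracle n O x u) →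
          ∀ b, M.OutputsWithin O' y [] (p.eval y.length) [b] → g y x = b := by
  classical
  refine ⟨fun y x => decide (M.OutputsWithin (cubeOracle n O x) y [] (p.eval y.length) [true]),
    fun x y hy => ?_⟩
  have ht : p.eval y.length ≤ (p.comp ℓ).eval n := by
    rw [Polynomial.eval_comp]
    exact eval_mono_nat p hy
  obtain ⟨C, hcard, hlen, hC⟩ := M.exists_queries_outputsWithin (cubeOracle n O x) y []
    (p.eval y.length)
  refine ⟨⟨Finset.univ.filter fun v => v.val ∈ C, Finset.subset_univ _, ?_, fun x' hx' => ?_⟩,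
    fun O' hO' b hb => ?_⟩
  · refine le_trans (Finset.card_le_card_of_injOn Subtype.val (fun v hv => ?_)
      Subtype.val_injective.injOn) (hcard.trans ht)
    simpa using hv
  · have := hC (cubeOracle n O x') (fun u hu => cubeOracle_congr fun v hv => hx' v (Or.inr (by
      simpa [hv] using hu))) [true]
    simp only [this]
  · have h := (hC O' (fun u hu => hO' u ((hlen u hu).trans ht)) [b]).1 hb
    cases b
    · refine decide_eq_false fun h' => ?_
      simpa using h.unique h'
    · exact decide_eq_true h

/-- At most points of the cube of oracles, the answers of a chain of verifiers are those of functions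
with small certificates on a large set of coordinates. -/
theorem exists_certified (M : Machine) (p : Polynomial ℕ) (Vs : List QMAVerifier)
    (ℓ : Polynomial ℕ) : ∃ Q s D : Polynomial ℕ, ∀ (n : ℕ) (O : BitLanguage),
      ∃ (R : Finset (List.Vector Bool n)) (G : Finset (List.Vector Bool n → Bool))
        (g : List Bool → (List.Vector Bool n → Bool) → Bool),
        2 ^ n ≤ Q.eval n * R.card ∧ 2 ^ n * Gᶜ.card ≤ 2 * Vs.length * 2 ^ 2 ^ n ∧
        ∀ x ∈ G, ∀ y, y.length ≤ ℓ.eval n → HasCert (g y) R x (s.eval n) ∧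
          ∀ O' : BitLanguage, (∀ u, u.length ≤ D.eval n → O' u = cubeOracle n O x u) →
            ∀ b, Decided M p O' Vs y b → g y x = b := by
  induction Vs generalizing ℓ with
  | nil =>
    refine ⟨1, p.comp ℓ, p.comp ℓ, fun n O => ?_⟩
    obtain ⟨g, hg⟩ := exists_certified_of_machine M p ℓ n O
    exact ⟨Finset.univ, Finset.univ, g, by simp [card_vector], by simp, fun x _ y hy => hg x y hy⟩
  | cons V Vs ih =>
    -- The lower chain has to be controlled on all strings that the circuits of `V` can query, and
    -- the length of these is bounded by the running time of the generator.
    obtain ⟨Q, s, D, h⟩ := ih (V.time.comp ℓ)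
    obtain ⟨t, ht⟩ : ∃ t, t = V.time.comp ℓ := ⟨_, rfl⟩
    obtain ⟨w, hw⟩ : ∃ w : Polynomial ℕ, ∀ n, w.eval n = ((s.eval n + 1) * t.eval n) *
        (144 * t.eval n) * (2 * ((n + (ℓ.eval n + 1)) +
          ((s.eval n + 1) * t.eval n) * (144 * t.eval n) + 20)) :=
      ⟨((s + 1) * t) * (144 * t) * (2 * ((Polynomial.X + (ℓ + 1)) +
          ((s + 1) * t) * (144 * t) + 20)), fun n => by simp⟩
    rw [← ht] at h
    refine ⟨Q * (2 * w * (16 * w + 1)), Polynomial.X + (ℓ + 1) + 1 + (16 * w + 1),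
      D + t, fun n O => ?_⟩
    obtain ⟨R, G, g, hR, hG, hg⟩ := h n O
    obtain ⟨T, hT⟩ : ∃ T, T = t.eval n := ⟨_, rfl⟩
    replace hw := hw n
    rw [← hT] at hg hw
    have hTime : ∀ y : List Bool, y.length ≤ ℓ.eval n → (V.circuit y).encode.length ≤ T := by
      intro y hy
      refine (V.generates y).length_le.trans ?_
      rw [hT, ht, Polynomial.eval_comp]
      exact eval_mono_nat _ hy
    have hT0 : 0 < T := (V.circuit []).length_encode_pos.trans_le (hTime [] (by simp))
    let Ax : (List.Vector Bool n → Bool) → BitLanguage := fun x =>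
      join (cubeOracle n O x) fun u => g u x
    have hν : ∀ (y : List Bool) (x : List.Vector Bool n → Bool),
        ∃ ν : List.Vector Bool n → ℝ, y ∈ shortStrings (ℓ.eval n) → x ∈ G →
        (∃ φ : QState (V.circuit y).witness, ‖φ‖ = 1 ∧
          2 / 3 ≤ (V.circuit y).acceptProb (Ax x) φ) →
        (∀ v, 0 ≤ ν v) ∧ ∑ v ∈ R, ν v ≤ ((s.eval n + 1) * T : ℕ) ∧
        ∀ x' : List.Vector Bool n → Bool, (∀ v, v ∉ R → x' v = x v) →
        ∑ v ∈ R with x' v ≠ x v, ν v < 1 / (144 * T : ℕ) →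
          ¬∀ φ : QState (V.circuit y).witness, ‖φ‖ = 1 →
            (V.circuit y).acceptProb (Ax x') φ ≤ 1 / 3 := by
      intro y x
      by_cases hyx : y ∈ shortStrings (ℓ.eval n) ∧ x ∈ G ∧
          ∃ φ : QState (V.circuit y).witness, ‖φ‖ = 1 ∧
            2 / 3 ≤ (V.circuit y).acceptProb (Ax x) φ
      · obtain ⟨hy, hx, φ, hφ, hacc⟩ := hyx
        obtain ⟨ν, h1, h2, h3⟩ := (V.circuit y).exists_coordinateWeight T
          (hTime y (mem_shortStrings.1 hy)) n O g R x (s.eval n) (fun u hu => (hg x hx u hu).1)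
          φ hφ hacc
        exact ⟨ν, fun _ _ _ => ⟨h1, h2, h3⟩⟩
      · exact ⟨0, fun h1 h2 h3 => absurd ⟨h1, h2, h3⟩ hyx⟩
    choose ν hν using hν
    have hcardY : 2 ^ n * (shortStrings (ℓ.eval n)).card ≤
        2 ^ (n + (ℓ.eval n + 1)) := by
      rw [pow_add 2 n]
      exact Nat.mul_le_mul_left _ (card_shortStrings_le _)
    obtain ⟨R', hR', G', hG', hbad, g', hg'⟩ := exists_separating (shortStrings (ℓ.eval n)) R G
      (fun y x => ∃ φ : QState (V.circuit y).witness, ‖φ‖ = 1 ∧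
          2 / 3 ≤ (V.circuit y).acceptProb (Ax x) φ)
      (fun y x => ∀ φ : QState (V.circuit y).witness, ‖φ‖ = 1 →
            (V.circuit y).acceptProb (Ax x) φ ≤ 1 / 3) ν
      ((s.eval n + 1) * T) (144 * T) (by positivity) (by positivity)
      (fun y hy x hx hyes => hν y x hy hx hyes) n (n + (ℓ.eval n + 1)) hcardY (w.eval n) hw
    refine ⟨R', G', g', ?_, ?_, fun x hx y hy => ?_⟩
    · refine hR.trans ((Nat.mul_le_mul_left _ hR').trans (le_of_eq ?_))
      simp
      ring
    · have hsub : G'ᶜ ⊆ Gᶜ ∪ (G \ G') := by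
        intro x hx
        simp only [Finset.mem_compl, Finset.mem_union, Finset.mem_sdiff] at hx ⊢
        tauto
      rw [card_vector, Fintype.card_bool] at hbad
      have := (Finset.card_le_card hsub).trans (Finset.card_union_le _ _)
      have := Nat.mul_le_mul_left (2 ^ n) this
      rw [List.length_cons]
      linarith
    · obtain ⟨h1, h2, h3⟩ := hg' y (mem_shortStrings.2 hy) x hx
      refine ⟨?_, fun O' hO' b hb => ?_⟩
      · have e : (Polynomial.X + (ℓ + 1) + 1 + (16 * w + 1)).eval n =
            n + (ℓ.eval n + 1) + 1 + (16 * w.eval n + 1) := by simp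
        rw [e]
        exact h1
      · rw [Polynomial.eval_add, ← hT] at hO'
        -- The certified functions are reliable only up to length `T`. Beyond it `A₀` supplies the
        -- answers, to obtain a genuine extension; the circuit cannot see that part.
        obtain ⟨A₀, hA₀⟩ := exists_forall_decided M p O' Vs
        have hdec := hb (fun z => if z.length ≤ T then g z x else A₀ z) (fun z c hz => by
          split_ifs with hzT
          · exact (hg x (hG' hx) z hzT).2 O' (fun u hu => hO' u (by omega)) c hz
          · exact hA₀ z c hz)
        have hcongr : ∀ φ, (V.circuit y).acceptProb
            (join O' fun z => if z.length ≤ T then g z x else A₀ z) φ =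
            (V.circuit y).acceptProb (Ax x) φ := by
          refine (V.circuit y).acceptProb_congr _ _ fun γ hγ q hq => ?_
          have hqT : q.length ≤ T := hq.trans (((V.circuit y).arity_le γ hγ).trans (hTime y hy))
          rcases q with _ | ⟨_ | _, u⟩
          · rfl
          · rw [List.length_cons] at hqT
            exact hO' u (by omega)
          · rw [List.length_cons] at hqT
            simp only [join, Ax]
            rw [if_pos (by omega)]
        simp only [hcongr] at hdec
        cases b
        · exact h3 (hdec.2 rfl)
        · exact h2 (hdec.1 rfl)

/-! ## Thresholds do not have small certificates -/

/-- The bound `k.centralBinom / 4 ^ k ≤ 1 / √(2 * k + 1)`, squared. Its induction step reduces to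
`(2 * k + 1) * (2 * k + 3) ≤ 4 * (k + 1) ^ 2`. -/
theorem centralBinom_sq_mul_le (k : ℕ) : k.centralBinom ^ 2 * (2 * k + 1) ≤ 16 ^ k := by
  induction k with
  | zero => simp
  | succ k ih =>
    have h := Nat.succ_mul_centralBinom_succ k
    refine le_of_mul_le_mul_left ?_ (show 0 < (k + 1) ^ 2 by positivity)
    calc (k + 1) ^ 2 * ((k + 1).centralBinom ^ 2 * (2 * (k + 1) + 1))
        = ((k + 1) * (k + 1).centralBinom) ^ 2 * (2 * k + 3) := by ring
      _ = (k.centralBinom ^ 2 * (2 * k + 1)) * (4 * ((2 * k + 1) * (2 * k + 3))) := by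
          rw [h]
          ring
      _ ≤ 16 ^ k * (4 * (4 * (k + 1) ^ 2)) :=
          Nat.mul_le_mul ih (Nat.mul_le_mul_left _ (by ring_nf; omega))
      _ = _ := by ring

theorem exists_centralBinom_le (ε : ℝ) (hε : 0 < ε) :
    ∃ k : ℕ, (k.centralBinom : ℝ) ≤ ε * 2 ^ (2 * k) := by
  obtain ⟨k, hk⟩ := exists_nat_gt (1 / ε ^ 2)
  refine ⟨k, ?_⟩
  have h : (k.centralBinom : ℝ) ^ 2 * (2 * k + 1) ≤ 16 ^ k := by
    exact_mod_cast centralBinom_sq_mul_le k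
  rw [div_lt_iff₀ (by positivity)] at hk
  rw [← sq_le_sq₀ (by positivity) (by positivity)]
  have e : (ε * 2 ^ (2 * k)) ^ 2 = ε ^ 2 * 16 ^ k := by
    rw [mul_pow, ← pow_mul, mul_comm (2 * k) 2, ← mul_assoc, pow_mul]
    norm_num
  rw [e]
  have h1 : (1 : ℝ) ≤ ε ^ 2 * (2 * k + 1) := by nlinarith [sq_nonneg ε]
  calc (k.centralBinom : ℝ) ^ 2 ≤ (k.centralBinom : ℝ) ^ 2 * (ε ^ 2 * (2 * k + 1)) :=
        le_mul_of_one_le_right (by positivity) h1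
    _ = ε ^ 2 * ((k.centralBinom : ℝ) ^ 2 * (2 * k + 1)) := by ring
    _ ≤ _ := mul_le_mul_of_nonneg_left h (by positivity)

theorem eventually_mul_eval_le_two_pow (P : Polynomial ℕ) :
    ∀ c : ℕ, ∀ᶠ n in Filter.atTop, c * P.eval n ≤ 2 ^ n := by
  induction P using Polynomial.induction_on' with
  | add p q hp hq =>
    intro c
    filter_upwards [hp (2 * c), hq (2 * c)] with n h1 h2
    rw [Polynomial.eval_add, mul_add]
    linarith
  | monomial d a =>
    intro c
    have h := tendsto_pow_const_div_const_pow_of_one_lt d (one_lt_two : (1 : ℝ) < 2)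
    have h1 := h.eventually_le_const (u := 1 / ((c * a : ℕ) + 1 : ℝ)) (by positivity)
    filter_upwards [h1] with n hn
    rw [Polynomial.eval_monomial, ← mul_assoc]
    rw [div_le_div_iff₀ (by positivity) (by positivity), one_mul] at hn
    have h2 : n ^ d * (c * a + 1) ≤ 2 ^ n := by exact_mod_cast hn
    nlinarith [Nat.zero_le (n ^ d)]

/-! ### Weight layers and blocks of free coordinates -/

section Threshold

variable {B : Type*} [DecidableEq B] [Fintype B]

/-- The number of ones. -/
def weight (x : B → Bool) : ℕ := (Finset.univ.filter fun v => x v = true).card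

theorem card_filter_eq_false_on (J : Finset B) :
    (Finset.univ.filter fun y : B → Bool => ∀ v ∈ J, y v = false).card =
      2 ^ (Fintype.card B - J.card) := by
  have e : (Finset.univ.filter fun y : B → Bool => ∀ v ∈ J, y v = false) =
      Fintype.piFinset fun v => if v ∈ J then {false} else Finset.univ := by
    ext y
    simp only [Finset.mem_filter, Finset.mem_univ, true_and, Fintype.mem_piFinset]
    refine forall_congr' fun v => ?_
    split_ifs with h <;> simp [h]
  rw [e, Fintype.card_piFinset, ← Finset.prod_mul_prod_compl J,
    Finset.prod_congr rfl (g := fun _ => 1), Finset.prod_congr (s₁ := Jᶜ) rfl (g := fun _ => 2)]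
  · rw [Finset.prod_const, Finset.prod_const, one_pow, one_mul, Finset.card_compl]
  · intro v hv
    rw [if_neg (Finset.mem_compl.1 hv)]
    simp
  · intro v hv
    rw [if_pos hv]
    simp

theorem weight_eq_add (x : B → Bool) (J : Finset B) :
    weight x = (J.filter fun v => x v = true).card + (Jᶜ.filter fun v => x v = true).card := by
  rw [weight, ← Finset.card_union_of_disjoint, ← Finset.filter_union, Finset.union_compl]
  exact Finset.disjoint_filter_filter disjoint_compl_right

/-- Points with the same coordinates off `J` and equal weight are few. -/
theorem card_le_of_weight_eq (J : Finset B) (k : ℕ) (hJ : J.card = 2 * k)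
    (S : Finset (B → Bool))
    (hS : ∀ x ∈ S, ∀ x' ∈ S, (∀ v, v ∉ J → x' v = x v) → weight x' = weight x) :
    S.card ≤ k.centralBinom * 2 ^ (Fintype.card B - 2 * k) := by
  rw [← hJ, ← card_filter_eq_false_on J]
  let π : (B → Bool) → B → Bool := fun x v => if v ∈ J then false else x v
  have hπ : ∀ x x', π x' = π x → ∀ v, v ∉ J → x' v = x v := by
    intro x x' h v hv
    simpa [π, hv] using congrFun h v
  -- The points are grouped by their coordinates off `J`. In a group the weight on `J` is constant,
  -- so a group has at most a central binomial coefficient of points.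
  refine le_trans (Finset.card_le_mul_card_image (f := π) S k.centralBinom ?_)
    (Nat.mul_le_mul_left _ (Finset.card_le_card ?_))
  · intro y hy
    obtain ⟨x, hx, rfl⟩ := Finset.mem_image.1 hy
    refine le_trans (Finset.card_le_card_of_injOn (t := J.powersetCard
      (J.filter fun v => x v = true).card) (fun x' => J.filter fun v => x' v = true) ?_ ?_) ?_
    · intro x' hx'
      rw [Finset.mem_coe, Finset.mem_filter] at hx'
      have hag := hπ x x' hx'.2
      have hw := hS x hx x' hx'.1 hag
      rw [weight_eq_add x J, weight_eq_add x' J] at hw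
      have e : (Jᶜ.filter fun v => x' v = true) = Jᶜ.filter fun v => x v = true :=
        Finset.filter_congr fun v hv => by rw [hag v (Finset.mem_compl.1 hv)]
      rw [e] at hw
      rw [Finset.mem_coe, Finset.mem_powersetCard]
      exact ⟨Finset.filter_subset _ _, Nat.add_right_cancel hw⟩
    · intro x1 h1 x2 h2 h12
      rw [Finset.mem_coe, Finset.mem_filter] at h1 h2
      funext v
      by_cases hv : v ∈ J
      · have := Finset.ext_iff.1 h12 v
        simp only [Finset.mem_filter, hv, true_and] at this
        exact Bool.eq_iff_iff.2 this
      · exact hπ x2 x1 (h1.2.trans h2.2.symm) v hv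
    · rw [Finset.card_powersetCard, hJ]
      exact Nat.choose_le_centralBinom _ _
  · intro y hy
    obtain ⟨x, hx, rfl⟩ := Finset.mem_image.1 hy
    simp only [Finset.mem_filter, Finset.mem_univ, true_and, π]
    intro v hv
    rw [if_pos hv]

/-- Functions with small certificates compute all threshold functions at few points only. -/
theorem mul_card_threshold_le (R : Finset B) (S : Finset (B → Bool)) (g : ℕ → (B → Bool) → Bool)
    (s k m : ℕ) (hm : m * (2 * k) ≤ R.card)
    (hS : ∀ x ∈ S, ∀ t, 1 ≤ t → t ≤ Fintype.card B →
      HasCert (g t) R x s ∧ (g t x = true ↔ t ≤ weight x)) :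
    m * S.card ≤ (2 * k + 1) * s * 2 ^ Fintype.card B +
      m * (k.centralBinom * 2 ^ (Fintype.card B - 2 * k)) := by
  classical
  -- The embedding provides `m` disjoint blocks of `2 * k` coordinates in `R`.
  obtain ⟨e⟩ : Nonempty (Fin m × Fin (2 * k) ↪ R) :=
    Function.Embedding.nonempty_of_card_le (by simpa using hm)
  have hcert : ∀ (x : B → Bool) (t : ℕ), ∃ C : Finset B, C.card ≤ s ∧
      (x ∈ S → 1 ≤ t → t ≤ Fintype.card B →
        ∀ x' : B → Bool, (∀ v, v ∉ R ∨ v ∈ C → x' v = x v) → g t x' = g t x) := by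
    intro x t
    by_cases h : x ∈ S ∧ 1 ≤ t ∧ t ≤ Fintype.card B
    · obtain ⟨C, -, hcard, hC⟩ := (hS x h.1 t h.2.1 h.2.2).1
      exact ⟨C, hcard, fun _ _ _ => hC⟩
    · exact ⟨∅, by simp, fun h1 h2 h3 => absurd ⟨h1, h2, h3⟩ h⟩
  choose C hCcard hC using hcert
  -- A change inside one block raises the weight by at most `2 * k`, so only the thresholds in this
  -- window matter.
  let W : (B → Bool) → Finset B := fun x =>
    (Finset.Icc (weight x) (weight x + 2 * k)).biUnion fun t => C x t
  have hW : ∀ x, (W x).card ≤ (2 * k + 1) * s := by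
    intro x
    refine Finset.card_biUnion_le.trans ((Finset.sum_le_sum fun t _ => hCcard x t).trans ?_)
    rw [Finset.sum_const, Nat.card_Icc, smul_eq_mul]
    exact Nat.mul_le_mul_right _ (by omega)
  let hit : Fin m → (B → Bool) → Prop := fun i x => ∃ j, (e (i, j) : B) ∈ W x
  have hhit : ∀ x, (Finset.univ.filter fun i => hit i x).card ≤ (2 * k + 1) * s := by
    intro x
    refine le_trans ?_ (hW x)
    have h1 : (Finset.univ.filter fun i => hit i x) ⊆
        (Finset.univ.filter fun p : Fin m × Fin (2 * k) => (e p : B) ∈ W x).image Prod.fst := by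
      intro i hi
      obtain ⟨j, hj⟩ := (Finset.mem_filter.1 hi).2
      exact Finset.mem_image.2 ⟨(i, j), by simpa using hj, rfl⟩
    refine (Finset.card_le_card h1).trans (Finset.card_image_le.trans ?_)
    refine Finset.card_le_card_of_injOn (fun p => (e p : B)) (fun p hp => ?_) ?_
    · simpa using hp
    · intro p _ p' _ h
      exact e.injective (Subtype.ext h)
  have hmiss : ∀ i, (S.filter fun x => ¬hit i x).card ≤
      k.centralBinom * 2 ^ (Fintype.card B - 2 * k) := by
    intro i
    let J : Finset B := Finset.univ.image fun j => (e (i, j) : B)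
    have hJR : J ⊆ R := by
      intro v hv
      obtain ⟨j, -, rfl⟩ := Finset.mem_image.1 hv
      exact (e (i, j)).2
    have hJ : J.card = 2 * k := by
      rw [Finset.card_image_of_injective, Finset.card_univ, Fintype.card_fin]
      intro j j' h
      exact (Prod.mk.inj (e.injective (Subtype.ext h))).2
    have hlt : ∀ x ∈ S.filter fun x => ¬hit i x, ∀ x' ∈ S, (∀ v, v ∉ J → x' v = x v) →
        ¬weight x < weight x' := by
      intro x hx x' hx' hag hw
      rw [Finset.mem_filter] at hx
      have hle : weight x' ≤ weight x + 2 * k := by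
        rw [← hJ]
        refine le_trans (Finset.card_le_card ?_) (Finset.card_union_le _ J)
        intro v hv
        rw [Finset.mem_union]
        by_cases hvJ : v ∈ J
        · exact Or.inr hvJ
        · rw [Finset.mem_filter, hag v hvJ] at hv
          exact Or.inl (Finset.mem_filter.2 hv)
      have h1 : 1 ≤ weight x' := by omega
      have h2 : weight x' ≤ Fintype.card B := Finset.card_le_univ _
      -- The threshold `weight x'` is reached by `x'` but not by `x`, although its certificate at
      -- `x` misses the block on which the two points differ.
      have h3 : g (weight x') x' = g (weight x') x := by
        refine hC x (weight x') hx.1 h1 h2 x' fun v hv => hag v fun hvJ => ?_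
        rcases hv with hv | hv
        · exact hv (hJR hvJ)
        · obtain ⟨j, -, rfl⟩ := Finset.mem_image.1 hvJ
          exact hx.2 ⟨j, Finset.mem_biUnion.2 ⟨weight x', Finset.mem_Icc.2 ⟨hw.le, hle⟩, hv⟩⟩
      have h4 := (hS x' hx' _ h1 h2).2.2 le_rfl
      have h5 := (hS x hx.1 _ h1 h2).2.1 (h3 ▸ h4)
      omega
    refine card_le_of_weight_eq J k hJ _ fun x hx x' hx' hag => ?_
    have h1 := hlt x hx x' (Finset.mem_filter.1 hx').1 hag
    have h2 := hlt x' hx' x (Finset.mem_filter.1 hx).1 fun v hv => (hag v hv).symm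
    omega
  calc m * S.card = ∑ i : Fin m, ((S.filter fun x => hit i x).card +
        (S.filter fun x => ¬hit i x).card) := by
        simp only [Finset.card_filter_add_card_filter_not]
        simp
    _ = ∑ x ∈ S, (Finset.univ.filter fun i => hit i x).card +
        ∑ i : Fin m, (S.filter fun x => ¬hit i x).card := by
        rw [Finset.sum_add_distrib]
        congr 1
        simp only [Finset.card_filter]
        rw [Finset.sum_comm]
    _ ≤ ∑ _x ∈ S, (2 * k + 1) * s +
        ∑ _i : Fin m, k.centralBinom * 2 ^ (Fintype.card B - 2 * k) :=
        add_le_add (Finset.sum_le_sum fun x _ => hhit x) (Finset.sum_le_sum fun i _ => hmiss i)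
    _ ≤ _ := by
        simp only [Finset.sum_const, smul_eq_mul, Finset.card_univ, Fintype.card_fin]
        refine Nat.add_le_add_right ?_ _
        rw [mul_comm S.card]
        refine Nat.mul_le_mul_left _ ((Finset.card_le_univ S).trans (le_of_eq ?_))
        simp

end Threshold

/-! ## A threshold language in `PP` -/

/-- For strings of equal length: `r` is at most `x` in the lexicographic order. -/
def lexLe : List Bool → List Bool → Bool
  | [], _ => true
  | false :: x, false :: r => lexLe x r
  | false :: _, true :: _ => false
  | true :: _, false :: _ => true
  | true :: x, true :: r => lexLe x r
  | _ :: _, [] => true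

/-- The number of strings of the length of `x` that are at most `x`. -/
def lexRank : List Bool → ℕ
  | [] => 1
  | false :: x => lexRank x
  | true :: x => 2 ^ x.length + lexRank x

theorem ncard_length_eq (n : ℕ) : {u : List Bool | u.length = n}.ncard = 2 ^ n := by
  rw [← Nat.card_coe_set_eq]
  change Nat.card (List.Vector Bool n) = _
  rw [Nat.card_eq_fintype_card, card_vector, Fintype.card_bool]

theorem finite_of_length_eq {S : Set (List Bool)} (n : ℕ) (hS : ∀ u ∈ S, u.length = n) :
    S.Finite :=
  (List.finite_length_eq Bool n).subset hS

theorem cons_injective (b : Bool) : Function.Injective fun u : List Bool => b :: u :=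
  fun _ _ h => (List.cons.inj h).2

/-- Counting a set of strings by the first bit. -/
theorem ncard_eq_add_of_first_bit (n : ℕ) (S S₀ S₁ : Set (List Bool)) (h0 : ∀ u ∈ S₀, u.length = n)
    (h1 : ∀ u ∈ S₁, u.length = n)
    (hS : ∀ u, u ∈ S ↔ (∃ r ∈ S₀, u = false :: r) ∨ ∃ r ∈ S₁, u = true :: r) :
    S.ncard = S₀.ncard + S₁.ncard := by
  have e : S = (fun u => false :: u) '' S₀ ∪ (fun u => true :: u) '' S₁ := by
    ext u
    simp only [hS, Set.mem_union, Set.mem_image, eq_comm]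
  rw [e, Set.ncard_union_eq ?_ ((finite_of_length_eq n h0).image _)
    ((finite_of_length_eq n h1).image _), Set.ncard_image_of_injective _ (cons_injective _),
    Set.ncard_image_of_injective _ (cons_injective _)]
  rw [Set.disjoint_left]
  rintro _ ⟨r, _, rfl⟩ ⟨r', _, h⟩
  simp at h

theorem ncard_lexLe (x : List Bool) :
    {r : List Bool | r.length = x.length ∧ lexLe x r = true}.ncard = lexRank x := by
  induction x with
  | nil =>
    have : {r : List Bool | r.length = ([] : List Bool).length ∧ lexLe [] r = true} = {[]} := by
      ext r
      simp [lexLe]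
    rw [this, Set.ncard_singleton, lexRank]
  | cons b x ih =>
    cases b
    · rw [ncard_eq_add_of_first_bit x.length _ {r | r.length = x.length ∧ lexLe x r = true} ∅
        (fun u hu => hu.1) (by simp), ih, Set.ncard_empty, lexRank, add_zero]
      rintro (_ | ⟨_ | _, u⟩) <;> simp [lexLe]
    · rw [ncard_eq_add_of_first_bit x.length _ {r | r.length = x.length}
        {r | r.length = x.length ∧ lexLe x r = true} (fun u hu => hu) (fun u hu => hu.1), ih,
        ncard_length_eq, lexRank]
      rintro (_ | ⟨_ | _, u⟩) <;> simp [lexLe]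

theorem exists_lexRank_eq (n v : ℕ) (h1 : 1 ≤ v) (h2 : v ≤ 2 ^ n) :
    ∃ x : List Bool, x.length = n ∧ lexRank x = v := by
  induction n generalizing v with
  | zero => exact ⟨[], rfl, by simp [lexRank]; omega⟩
  | succ n ih =>
    by_cases hv : v ≤ 2 ^ n
    · obtain ⟨x, hx, hr⟩ := ih v h1 hv
      exact ⟨false :: x, by simp [hx], by simp [lexRank, hr]⟩
    · rw [pow_succ] at h2
      obtain ⟨x, hx, hr⟩ := ih (v - 2 ^ n) (by omega) (by omega)
      exact ⟨true :: x, by simp [hx], by simp [lexRank, hr, hx]; omega⟩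

/-- The number of strings of length `n` in the oracle. -/
noncomputable def oracleCount (O : BitLanguage) (n : ℕ) : ℕ :=
  {u : List Bool | u.length = n ∧ O u = true}.ncard

/-- The language that compares the number of strings of length `|x|` in the oracle with a threshold
given by `x`. -/
noncomputable def thresholdLanguage (O : BitLanguage) : BitLanguage := fun x =>
  decide (2 ^ x.length < oracleCount O x.length + lexRank x)

/-- If the first random bit is `0`, the other ones are the query to the oracle; otherwise they are
compared with the input. -/
def thresholdMachine : Machine :=
  -- Positions `1` to `4` move the random string to the query tape and ask; `5` to `7` compare bit
  -- by bit; `8` and `9` write the answer; `10` halts.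
  [.pop 1 10 1 5, .pop 1 4 2 3, .push 2 false 1, .push 2 true 1, .query 9 8,
    .pop 0 8 6 7, .pop 1 8 5 9, .pop 1 8 8 5, .push 3 true 10, .push 3 false 10]

/-- After `t` steps from `c`, the machine has halted with the output `[b]`. -/
def Machine.OutputsFrom (M : Machine) (O : BitLanguage) (t : ℕ) (c : Config) (b : Bool) : Prop :=
  M.step O (M.run O t c) = none ∧ (M.run O t c).stack 3 = [b]

theorem Machine.OutputsFrom.of_step {M : Machine} {O : BitLanguage} {t : ℕ} {c c' : Config}
    {b : Bool} (hs : M.step O c = some c') (h : M.OutputsFrom O t c' b) :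
    M.OutputsFrom O (t + 1) c b := by
  unfold Machine.OutputsFrom at h ⊢
  simpa only [Machine.run, hs] using h

theorem Machine.outputsFrom_of_step_eq_none {M : Machine} {O : BitLanguage} (t : ℕ) {c : Config}
    {b : Bool} (hs : M.step O c = none) (h : c.stack 3 = [b]) : M.OutputsFrom O t c b := by
  have : M.run O t c = c := by
    cases t <;> simp [Machine.run, hs]
  unfold Machine.OutputsFrom
  rw [this]
  exact ⟨hs, h⟩

theorem thresholdMachine_output (O : BitLanguage) (t : ℕ) (st : ℕ → List Bool) (h3 : st 3 = [])
    (b : Bool) : thresholdMachine.OutputsFrom O (t + 1) ⟨if b then 8 else 9, st⟩ b := by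
  cases b
  · refine Machine.OutputsFrom.of_step (c' := ⟨10, Function.update st 3 [false]⟩) ?_
      (Machine.outputsFrom_of_step_eq_none t ?_ ?_)
    · simp [Machine.step, thresholdMachine, h3]
    · simp [Machine.step, thresholdMachine]
    · simp
  · refine Machine.OutputsFrom.of_step (c' := ⟨10, Function.update st 3 [true]⟩) ?_
      (Machine.outputsFrom_of_step_eq_none t ?_ ?_)
    · simp [Machine.step, thresholdMachine, h3]
    · simp [Machine.step, thresholdMachine]
    · simp

/-- Moving a string from stack to stack reverses it, so the loop accumulates `r.reverse` on the
query tape, at two steps per bit; `t` is slack. -/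
theorem thresholdMachine_query (O : BitLanguage) (t : ℕ) (r : List Bool) (st : ℕ → List Bool)
    (h1 : st 1 = r) (h3 : st 3 = []) :
    thresholdMachine.OutputsFrom O (t + 2 * r.length + 3) ⟨1, st⟩ (O (r.reverse ++ st 2)) := by
  induction r generalizing st with
  | nil =>
    refine Machine.OutputsFrom.of_step (t := t + 2) (c' := ⟨4, st⟩) ?_
      (Machine.OutputsFrom.of_step (t := t + 1) (c' := ⟨if O (st 2) then 8 else 9, st⟩) ?_ ?_)
    · simp [Machine.step, thresholdMachine, h1]
    · simp [Machine.step, thresholdMachine]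
    · exact thresholdMachine_output O t st h3 _
  | cons b r ih =>
    have h := ih (Function.update (Function.update st 1 r) 2 (b :: st 2)) (by simp) (by simp [h3])
    rw [Function.update_self] at h
    rw [List.reverse_cons, List.append_assoc, List.singleton_append]
    refine Machine.OutputsFrom.of_step (t := t + 2 * r.length + 4)
      (c' := ⟨if b then 3 else 2, Function.update st 1 r⟩) ?_
      (Machine.OutputsFrom.of_step (t := t + 2 * r.length + 3) ?_ h)
    · cases b <;> simp [Machine.step, thresholdMachine, h1]
    · cases b <;> simp [Machine.step, thresholdMachine]

theorem thresholdMachine_compare (O : BitLanguage) (t : ℕ) (x r : List Bool)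
    (st : ℕ → List Bool) (h0 : st 0 = x) (h1 : st 1 = r) (h3 : st 3 = [])
    (hlen : r.length = x.length) :
    thresholdMachine.OutputsFrom O (t + 2 * x.length + 3) ⟨5, st⟩ (lexLe x r) := by
  induction x generalizing r st with
  | nil =>
    refine Machine.OutputsFrom.of_step (t := t + 2) (c' := ⟨8, st⟩) ?_ ?_
    · simp [Machine.step, thresholdMachine, h0]
    · exact thresholdMachine_output O (t + 1) st h3 true
  | cons a x ih =>
    rcases r with _ | ⟨b, r⟩
    · simp at hlen
    · have h := ih r (Function.update (Function.update st 0 x) 1 r) (by simp) (by simp)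
        (by simp [h3]) (by simpa using hlen)
      have h3' : (Function.update (Function.update st 0 x) 1 r) 3 = [] := by simp [h3]
      refine Machine.OutputsFrom.of_step (t := t + 2 * x.length + 4)
        (c' := ⟨if a then 7 else 6, Function.update st 0 x⟩) ?_
        (Machine.OutputsFrom.of_step (t := t + 2 * x.length + 3)
          (c' := ⟨if a = b then 5 else if a then 8 else 9,
            Function.update (Function.update st 0 x) 1 r⟩) ?_ ?_)
      · cases a <;> simp [Machine.step, thresholdMachine, h0]
      · cases a <;> cases b <;> simp [Machine.step, thresholdMachine, h1]
      · cases a <;> cases b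
        · exact h
        · exact thresholdMachine_output O _ _ h3' false
        · exact thresholdMachine_output O _ _ h3' true
        · exact h

theorem thresholdMachine_outputsWithin (O : BitLanguage) (x : List Bool) (b : Bool) (r : List Bool)
    (hlen : r.length = x.length) :
    thresholdMachine.OutputsWithin O x (b :: r) (2 * x.length + 4)
      [if b then lexLe x r else O r.reverse] := by
  have hx : ∀ st : ℕ → List Bool, st = Function.update (initConfig x (b :: r)).stack 1 r →
      thresholdMachine.OutputsFrom O (2 * x.length + 4) (initConfig x (b :: r))
        (if b then lexLe x r else O r.reverse) := by
    intro st hst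
    refine Machine.OutputsFrom.of_step (t := 2 * x.length + 3) (c' := ⟨if b then 5 else 1, st⟩)
      ?_ ?_
    · cases b <;> simp [Machine.step, thresholdMachine, initConfig, hst]
    · cases b
      · have := thresholdMachine_query O 0 r st (by simp [hst]) (by simp [hst, initConfig])
        have h2 : st 2 = [] := by simp [hst, initConfig]
        rw [h2, hlen, List.append_nil, zero_add] at this
        exact this
      · have := thresholdMachine_compare O 0 x r st (by simp [hst, initConfig]) (by simp [hst])
          (by simp [hst, initConfig]) hlen
        rw [zero_add] at this
        exact this
  exact hx _ rfl

/-- Of the `2 ^ (n + 1)` random strings, those starting with `0` contribute `oracleCount O n`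
accepting ones (reversal is a bijection) and those starting with `1` contribute `lexRank x`. A
strict majority means that the sum exceeds `2 ^ n`. -/
theorem thresholdLanguage_mem_PP (O : BitLanguage) : thresholdLanguage O ∈ PP O := by
  refine ⟨thresholdMachine, 2 * Polynomial.X + 4, Polynomial.X + 1, fun x => ?_⟩
  have hp : (2 * Polynomial.X + 4 : Polynomial ℕ).eval x.length = 2 * x.length + 4 := by simp
  have hq : (Polynomial.X + 1 : Polynomial ℕ).eval x.length = x.length + 1 := by simp
  rw [hp, hq]
  constructor
  · rintro (_ | ⟨b, r⟩) hr
    · simp at hr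
    · exact ⟨_, thresholdMachine_outputsWithin O x b r (by simpa using hr)⟩
  · have hrev : Function.Injective (List.reverse : List Bool → List Bool) := List.reverse_injective
    rw [ncard_eq_add_of_first_bit x.length _
      (List.reverse '' {u : List Bool | u.length = x.length ∧ O u = true})
      {r | r.length = x.length ∧ lexLe x r = true}
      (by rintro _ ⟨u, hu, rfl⟩; simpa using hu.1) (fun u hu => hu.1),
      Set.ncard_image_of_injective _ hrev, ncard_lexLe]
    · rw [thresholdLanguage, decide_eq_true_iff, oracleCount, pow_succ]
      omega
    · have key : ∀ (b : Bool) (r : List Bool), r.length = x.length →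
          (thresholdMachine.OutputsWithin O x (b :: r) (2 * x.length + 4) [true] ↔
            (if b then lexLe x r else O r.reverse) = true) := by
        intro b r hr
        have h := thresholdMachine_outputsWithin O x b r hr
        refine ⟨fun h' => by simpa using h.unique h', fun h' => ?_⟩
        rw [h'] at h
        exact h
      rintro (_ | ⟨b, r⟩)
      · simp
      · simp only [Set.mem_ofPred_eq, List.length_cons, Nat.add_right_cancel_iff, Set.mem_image]
        constructor
        · rintro ⟨hr, h⟩
          rw [key b r hr] at h
          cases b
          · exact Or.inl ⟨r, ⟨r.reverse, ⟨by simpa using hr, h⟩, by simp⟩, rfl⟩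
          · exact Or.inr ⟨r, ⟨hr, h⟩, rfl⟩
        · rintro (⟨r', ⟨u, ⟨hu, hO⟩, rfl⟩, h⟩ | ⟨r', ⟨hr, hle⟩, h⟩)
          · obtain ⟨rfl, rfl⟩ := List.cons.inj h
            have hl : u.reverse.length = x.length := by simpa using hu
            exact ⟨hl, (key false _ hl).2 (by simpa using hO)⟩
          · obtain ⟨rfl, rfl⟩ := List.cons.inj h
            exact ⟨hr, (key true _ hr).2 hle⟩

/-! ## A fixed chain of verifiers almost surely fails -/

/-- Some oracle that agrees with `O` on the strings of length at most `d` is such that the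
chain of verifiers decides the threshold language on all inputs of length `n`. -/
def SucceedsAt (M : Machine) (p : Polynomial ℕ) (Vs : List QMAVerifier) (d n : ℕ)
    (O : BitLanguage) : Prop :=
  ∃ O' : BitLanguage, (∀ u, u.length ≤ d → O' u = O u) ∧
    ∀ y : List Bool, y.length = n → Decided M p O' Vs y (thresholdLanguage O' y)

theorem oracleCount_cubeOracle (n : ℕ) (O O' : BitLanguage) (x : List.Vector Bool n → Bool)
    (h : ∀ u, u.length = n → O' u = cubeOracle n O x u) : oracleCount O' n = weight x := by
  have e : {u : List Bool | u.length = n ∧ O' u = true} =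
      ((Finset.univ.filter fun v => x v = true).image List.Vector.toList : Finset (List Bool)) := by
    ext u
    simp only [Set.mem_ofPred_eq, Finset.coe_image, Finset.coe_filter, Finset.mem_univ, true_and,
      Set.mem_image]
    constructor
    · rintro ⟨hu, hO⟩
      rw [h u hu, cubeOracle, dif_pos hu] at hO
      exact ⟨⟨u, hu⟩, hO, rfl⟩
    · rintro ⟨v, hv, rfl⟩
      refine ⟨v.toList_length, ?_⟩
      rw [h _ v.toList_length, cubeOracle, dif_pos v.toList_length]
      exact hv
  rw [oracleCount, e, Set.ncard_coe_finset, Finset.card_image_of_injective _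
    List.Vector.toList_injective, weight]

open Classical in
/-- On every cube of oracles, the chain of verifiers succeeds at a small fraction of the points. -/
theorem exists_card_succeedsAt_le (M : Machine) (p : Polynomial ℕ) (Vs : List QMAVerifier)
    (ε : ℝ) (hε : 0 < ε) : ∃ d n : ℕ, ∀ O : BitLanguage,
      ((Finset.univ.filter fun x : List.Vector Bool n → Bool =>
        SucceedsAt M p Vs d n (cubeOracle n O x)).card : ℝ) ≤ ε * 2 ^ 2 ^ n := by
  obtain ⟨Q, s, D, h⟩ := exists_certified M p Vs Polynomial.X
  -- Three losses of `ε / 3` each: `k` for the missed blocks, `c` (through the number `m` of blocks)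
  -- for the hit blocks, and `e` for the points outside `G`. Then `n` is so large that `R` has room
  -- for the blocks and `e ≤ 2 ^ n`.
  obtain ⟨k, hk⟩ := exists_centralBinom_le (ε / 3) (by positivity)
  obtain ⟨c, hc⟩ := exists_nat_ge (3 * (2 * k + 1) / ε)
  obtain ⟨e, he⟩ := exists_nat_ge (3 * (2 * Vs.length) / ε)
  obtain ⟨n, h1, h2⟩ := ((eventually_mul_eval_le_two_pow
    (Q * ((Polynomial.C c * s + 1) * Polynomial.C (2 * k))) 1).and
    (eventually_mul_eval_le_two_pow (Polynomial.C e) 1)).exists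
  refine ⟨D.eval n + n, n, fun O => ?_⟩
  obtain ⟨R, G, g, hR, hG, hg⟩ := h n O
  have hcardB : Fintype.card (List.Vector Bool n) = 2 ^ n := by rw [card_vector, Fintype.card_bool]
  set succ := Finset.univ.filter fun x : List.Vector Bool n → Bool =>
        SucceedsAt M p Vs (D.eval n + n) n (cubeOracle n O x) with hsucc
  obtain ⟨m, hm⟩ : ∃ m, m = c * s.eval n + 1 := ⟨_, rfl⟩
  have hm0 : (0 : ℝ) < m := by
    rw [hm]
    positivity
  have hmR : m * (2 * k) ≤ R.card := by
    have hQ : 0 < Q.eval n := by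
      rcases Nat.eq_zero_or_pos (Q.eval n) with h0 | h0
      · rw [h0, zero_mul] at hR
        exact absurd hR (by simp)
      · exact h0
    have : Q.eval n * (m * (2 * k)) ≤ Q.eval n * R.card := by
      refine le_trans (le_of_eq ?_) (h1.trans hR)
      simp [hm]
    exact Nat.le_of_mul_le_mul_left this hQ
  -- The input of rank `2 ^ n + 1 - t` asks exactly whether the count is at least `t`.
  have hrank : ∀ t : ℕ, ∃ y : List Bool, 1 ≤ t → t ≤ 2 ^ n →
      y.length = n ∧ lexRank y = 2 ^ n + 1 - t := by
    intro t
    by_cases ht : 1 ≤ t ∧ t ≤ 2 ^ n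
    · obtain ⟨y, hy⟩ := exists_lexRank_eq n (2 ^ n + 1 - t) (by omega) (by omega)
      exact ⟨y, fun _ _ => hy⟩
    · exact ⟨[], fun h1 h2 => absurd ⟨h1, h2⟩ ht⟩
  choose y hy using hrank
  have hS := mul_card_threshold_le R (succ ∩ G) (fun t => g (y t)) (s.eval n) k m hmR (by
    intro x hx t ht1 ht2
    rw [hcardB] at ht2
    rw [Finset.mem_inter, hsucc, Finset.mem_filter] at hx
    obtain ⟨⟨-, O', hO', hdec⟩, hxG⟩ := hx
    obtain ⟨hlen, hrk⟩ := hy t ht1 ht2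
    obtain ⟨hcert, hval⟩ := hg x hxG (y t) (by rw [Polynomial.eval_X, hlen])
    refine ⟨hcert, ?_⟩
    rw [hval O' (fun u hu => hO' u (by omega)) _ (hdec (y t) hlen), thresholdLanguage,
      decide_eq_true_iff, hlen, hrk,
      oracleCount_cubeOracle n O O' x fun u hu => hO' u (by omega)]
    omega)
  rw [hcardB] at hS
  have hsplit : succ.card ≤ Gᶜ.card + (succ ∩ G).card := by
    refine (Finset.card_le_card fun x hx => ?_).trans (Finset.card_union_le _ _)
    rw [Finset.mem_union, Finset.mem_compl, Finset.mem_inter]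
    by_cases hxG : x ∈ G
    · exact Or.inr ⟨hx, hxG⟩
    · exact Or.inl hxG
  have b1 : (Gᶜ.card : ℝ) ≤ ε / 3 * 2 ^ 2 ^ n := by
    have hG' : (2 : ℝ) ^ n * Gᶜ.card ≤ 2 * Vs.length * 2 ^ 2 ^ n := by exact_mod_cast hG
    have h2' : (e : ℝ) ≤ 2 ^ n := by
      have : e ≤ 2 ^ n := by simpa using h2
      exact_mod_cast this
    have h3 : 2 * (Vs.length : ℝ) ≤ ε / 3 * 2 ^ n := by
      have := he.trans h2'
      rw [div_le_iff₀ hε] at this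
      linarith
    refine le_of_mul_le_mul_left (hG'.trans ?_) (show (0 : ℝ) < 2 ^ n by positivity)
    calc 2 * (Vs.length : ℝ) * 2 ^ 2 ^ n ≤ ε / 3 * 2 ^ n * 2 ^ 2 ^ n :=
          mul_le_mul_of_nonneg_right h3 (by positivity)
      _ = _ := by ring
  have b2 : ((succ ∩ G).card : ℝ) ≤ ε / 3 * 2 ^ 2 ^ n + ε / 3 * 2 ^ 2 ^ n := by
    have hS' : (m : ℝ) * (succ ∩ G).card ≤ (2 * k + 1) * s.eval n * 2 ^ 2 ^ n +
        m * (k.centralBinom * 2 ^ (2 ^ n - 2 * k)) := by exact_mod_cast hS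
    have h3 : (2 * k + 1 : ℝ) * s.eval n ≤ m * (ε / 3) := by
      have hc' : (2 * k + 1 : ℝ) ≤ c * (ε / 3) := by
        rw [div_le_iff₀ hε] at hc
        linarith
      have hmr : (m : ℝ) = c * s.eval n + 1 := by
        rw [hm]
        push_cast
        ring
      calc (2 * k + 1 : ℝ) * s.eval n ≤ c * (ε / 3) * s.eval n :=
            mul_le_mul_of_nonneg_right hc' (by positivity)
        _ ≤ (c * s.eval n + 1) * (ε / 3) := by linarith
        _ = _ := by rw [hmr]
    have h2k : 2 * k ≤ 2 ^ n := by
      have h4 : R.card ≤ 2 ^ n := hcardB ▸ Finset.card_le_univ R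
      have h5 : 1 * (2 * k) ≤ m * (2 * k) := Nat.mul_le_mul_right _ (by omega)
      omega
    have h4 : (k.centralBinom : ℝ) * 2 ^ (2 ^ n - 2 * k) ≤ ε / 3 * 2 ^ 2 ^ n := by
      calc (k.centralBinom : ℝ) * 2 ^ (2 ^ n - 2 * k)
          ≤ ε / 3 * 2 ^ (2 * k) * 2 ^ (2 ^ n - 2 * k) :=
            mul_le_mul_of_nonneg_right hk (by positivity)
        _ = ε / 3 * 2 ^ 2 ^ n := by rw [mul_assoc, ← pow_add, Nat.add_sub_cancel' h2k]
    refine le_of_mul_le_mul_left (hS'.trans ?_) hm0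
    have h5 := mul_le_mul_of_nonneg_right h3 (show (0 : ℝ) ≤ 2 ^ 2 ^ n by positivity)
    have h6 := mul_le_mul_of_nonneg_left h4 hm0.le
    linarith
  have hsplit' : (succ.card : ℝ) ≤ Gᶜ.card + (succ ∩ G).card := by exact_mod_cast hsplit
  linarith

/-! ## The random oracle -/

open MeasureTheory

instance : IsProbabilityMeasure randomOracle := by
  unfold randomOracle
  infer_instance

/-- A property of oracles that depends on the strings of bounded length only is measurable. -/
theorem measurableSet_of_short (d : ℕ) (E : Set BitLanguage)
    (hE : ∀ O O' : BitLanguage, (∀ u, u.length ≤ d → O' u = O u) → O ∈ E → O' ∈ E) :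
    MeasurableSet E := by
  let r : BitLanguage → (shortStrings d → Bool) := fun O u => O u
  have hr : Measurable r := measurable_pi_lambda _ fun u => measurable_pi_apply _
  have e : E = r ⁻¹' (r '' E) := by
    refine (Set.subset_preimage_image r E).antisymm ?_
    rintro O' ⟨O, hO, h⟩
    refine hE O O' (fun u hu => ?_) hO
    exact (congrFun h ⟨u, mem_shortStrings.2 hu⟩).symm
  rw [e]
  exact hr (Set.toFinite _).measurableSet

/-- Adding a fixed language preserves the law of the random oracle. -/
theorem measurePreserving_xor (z : BitLanguage) :
    MeasurePreserving (fun (O : BitLanguage) u => xor (O u) (z u)) randomOracle randomOracle := by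
  refine ⟨measurable_pi_lambda _ fun u => (measurable_of_finite fun b : Bool => xor b (z u)).comp
    (measurable_pi_apply u), ?_⟩
  unfold randomOracle
  have h := Measure.infinitePi_map_pi (μ := fun _ : List Bool =>
    (PMF.uniformOfFintype Bool).toMeasure) (f := fun u (b : Bool) => xor b (z u))
    (fun u => measurable_of_finite _)
  rw [h]
  congr 1
  funext u
  rw [PMF.toMeasure_map _ _ (measurable_of_finite _)]
  congr 1
  ext b
  rw [PMF.map_apply, tsum_bool]
  cases b <;> cases z u <;> simp

open Classical in
/-- The probability of an event that is unlikely on every cube is small. -/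
theorem randomOracle_le_of_cube (n : ℕ) (E : Set BitLanguage) (hE : MeasurableSet E) (ε : ℝ)
    (h : ∀ O : BitLanguage, ((Finset.univ.filter fun x : List.Vector Bool n → Bool =>
      cubeOracle n O x ∈ E).card : ℝ) ≤ ε * 2 ^ 2 ^ n) :
    randomOracle E ≤ ENNReal.ofReal ε := by
  -- Instead of conditioning on the oracle off length `n`, the measure is averaged over all shifts
  -- supported on length `n`, each of which preserves it. For fixed `O` the shifted oracles run
  -- through its cube exactly once.
  let z : (List.Vector Bool n → Bool) → BitLanguage := fun x => cubeOracle n (fun _ => false) x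
  have h1 : ∀ x, ∫⁻ O, E.indicator 1 (fun u => xor (O u) (z x u)) ∂randomOracle =
      randomOracle E := by
    intro x
    rw [(measurePreserving_xor (z x)).lintegral_comp (f := E.indicator 1)
      (measurable_one.indicator hE), lintegral_indicator_one hE]
  have h2 : ∑ x : List.Vector Bool n → Bool,
      ∫⁻ O, E.indicator 1 (fun u => xor (O u) (z x u)) ∂randomOracle =
      2 ^ 2 ^ n * randomOracle E := by
    simp only [h1, Finset.sum_const, Finset.card_univ, Fintype.card_fun, card_vector,
      Fintype.card_bool, nsmul_eq_mul]
    push_cast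
    rfl
  have h3 : ∀ O : BitLanguage, ∑ x : List.Vector Bool n → Bool,
      E.indicator (1 : BitLanguage → ENNReal) (fun u => xor (O u) (z x u)) ≤
        ENNReal.ofReal (ε * 2 ^ 2 ^ n) := by
    intro O
    have e1 : ∀ x : List.Vector Bool n → Bool, (fun u => xor (O u) (z x u)) =
        cubeOracle n O (fun v => xor (O v.val) (x v)) := by
      intro x
      funext u
      simp only [z, cubeOracle]
      split_ifs <;> simp
    have inv : Function.Involutive fun (x : List.Vector Bool n → Bool) v =>
        xor (O v.val) (x v) := by
      intro x
      funext v
      simp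
    simp only [e1]
    refine (Equiv.sum_comp inv.toPerm fun x => E.indicator (1 : BitLanguage → ENNReal)
      (cubeOracle n O x)).trans_le ?_
    simp only [Set.indicator_apply, Pi.one_apply]
    rw [← Nat.cast_one, ← Nat.cast_zero]
    simp only [← Nat.cast_ite]
    rw [← Nat.cast_sum, ← Finset.card_filter, ← ENNReal.ofReal_natCast]
    exact ENNReal.ofReal_le_ofReal (h O)
  have h4 : 2 ^ 2 ^ n * randomOracle E ≤ ENNReal.ofReal (ε * 2 ^ 2 ^ n) := by
    rw [← h2, ← lintegral_finsetSum]
    · refine (lintegral_mono h3).trans ?_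
      simp
    · intro x _
      exact (measurable_one.indicator hE).comp (measurePreserving_xor (z x)).measurable
  rw [mul_comm ε, ENNReal.ofReal_mul (by positivity), ENNReal.ofReal_pow (by norm_num),
    ENNReal.ofReal_ofNat] at h4
  exact (ENNReal.mul_le_mul_iff_right (by positivity) (by finiteness)).1 h4

/-- For each `ε` a single length `n` suffices. Success of the chain is contained in the event
`SucceedsAt`, with `O` as its own witness, and that event is measurable because it depends on short
strings only. -/
theorem ae_not_decided (M : Machine) (p : Polynomial ℕ) (Vs : List QMAVerifier) :
    ∀ᵐ O ∂randomOracle, ¬∀ y, Decided M p O Vs y (thresholdLanguage O y) := by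
  rw [ae_iff]
  refine le_antisymm (ENNReal.le_of_forall_pos_le_add fun ε hε _ => ?_) zero_le
  obtain ⟨d, n, h⟩ := exists_card_succeedsAt_le M p Vs ε (by exact_mod_cast hε)
  have hmeas : MeasurableSet {O | SucceedsAt M p Vs d n O} := by
    refine measurableSet_of_short d _ ?_
    rintro O O' hOO' ⟨O₁, h1, h2⟩
    exact ⟨O₁, fun u hu => (h1 u hu).trans (hOO' u hu).symm, h2⟩
  have := randomOracle_le_of_cube n _ hmeas ε h
  rw [zero_add]
  refine (measure_mono fun O hO => ?_).trans (this.trans (by simp))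
  simp only [not_not, Set.mem_ofPred_eq] at hO
  exact ⟨O, fun _ _ => rfl, fun y _ => hO y⟩

end QMAHierarchy

/-- With probability `1` over a random oracle `O`, the class `PP` relative to `O` is not contained in
the `QMA` hierarchy relative to `O`. -/
theorem mainTheorem2 :
    ∀ᵐ O ∂QMAHierarchy.randomOracle, ¬ QMAHierarchy.PP O ⊆ QMAHierarchy.QMAH O := by
  have h : ∀ᵐ O ∂QMAHierarchy.randomOracle,
      ∀ c : List QMAHierarchy.Instr × Polynomial ℕ × List QMAHierarchy.QMAVerifier,
        -- The triples of program, time bound and list of verifiers are countable, so the null sets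
        -- can be united.
        ¬∀ y, QMAHierarchy.Decided c.1 c.2.1 O c.2.2 y (QMAHierarchy.thresholdLanguage O y) :=
    MeasureTheory.ae_all_iff.2 fun c => QMAHierarchy.ae_not_decided c.1 c.2.1 c.2.2
  filter_upwards [h] with O hO hsub
  have hmem := hsub (QMAHierarchy.thresholdLanguage_mem_PP O)
  simp only [QMAHierarchy.QMAH, QMAHierarchy.PromiseQMAH, Set.mem_ofPred_eq, Set.mem_iUnion] at hmem
  obtain ⟨k, -, hk⟩ := hmem
  obtain ⟨M, p, Vs, hdec⟩ := QMAHierarchy.exists_decided_of_mem_level O k _ hk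
  exact hO (M, p, Vs) fun y => hdec y _ rfl
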